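/- Let $M_2=M_2(\mathbb C)$, with Pauli matrices $\sigma^X,\sigma^Y,\sigma^Z$, $S^U=\sigma^U/2$, $\rho=\mathbb 1/2$. All matrix spaces carry the Hilbert–Schmidt inner product $\langle A,B\rangle=\mathrm{Tr}(A^*B)$ with norm $\|\cdot\|_2$; $|A\rangle\langle B|$ is the map $C\mapsto\langle B,C\rangle A$, and for a linear map $T$ between such spaces, $\|T\|_\infty=\sup_{A\ne0}\|T(A)\|_2/\|A\|_2$, which is the largest singular value of $T$. Put $\mathbb E=|\mathbb 1\rangle\langle\rho|-\frac13\sum_{U}|\sigma^U\rangle\langle S^U|:M_2\to M_2$ and $K=|{\uparrow}\rangle\langle{\downarrow}|-|{\downarrow}\rangle\langle{\uparrow}|$. Let $\phi^m_k\in(\mathbb C^2)^{\otimes m}$ be the normalized symmetric vector with $k$ up spins. For an integer $d\ge 3$ and $0\le k\le d$ let $$W_k^d=K\Big(\sqrt{\tfrac{d-k}{d}}\,|{\downarrow}\rangle\langle\phi_k^{d-1}|+\sqrt{\tfrac kd}\,|{\uparrow}\rangle\langle\phi_{k-1}^{d-1}|\Big),$$ where a term with zero coefficient is omitted. For an integer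 $n\ge0$ let $$\mathbb E_L^{(d,n)}=(\mathbb E^{\otimes(d-1)})^n\circ\mathbb E_L^{(d,0)}:M_2\to M_2^{\otimes(d-1)},\qquad \mathbb E_L^{(d,0)}(B)=\sum_{k=0}^d (W_k^d)^*BW_k^d,$$ and $Q_L^{(d,n)}=\mathbb E_L^{(d,n)}(\mathbb 1)$, a Hermitian matrix. An $r$-matching of $[m]=\{1,\dots,m\}$ is a set $p$ of $r$ pairwise disjoint unordered pairs in $[m]$. Let $M^{(m)}_r=\sum_p\prod_{\{i,j\}\in p}\mathbf S_i\cdot\mathbf S_j$, where $p$ runs over the $r$-matchings of $[m]$ and $\mathbf S_i\cdot\mathbf S_j=\sum_U S^U_iS^U_j$ acts on the tensor factors $i$ and $j$ of $(\mathbb C^2)^{\otimes m}$ (so $M^{(m)}_0=\mathbb 1$). Put $$V_\rho^{(m)}(\alpha)=\sum_{r=0}^{\lfloor m/2\rfloor}\frac{\alpha^{2r}}{(2r+1)!!}M_r^{(m)},\qquad \alpha_n=2(-1/3)^n .$$ **Lemma.** Let $d\ge3$ and $n\ge0$ be integers. The minimal eigenvalue $q_L^{(d,n)}$ of $Q_L^{(d,n)}$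 satisfies $$q_L^{(d,n)}\ \ge\ \frac{d+1}{3\cdot2^{d-1}}\Big(4-(1+3^{-n+1/2})^{d-1}\Big).$$ Moreover, $Q_L^{(d,n)}$ is invertible for every $n\ge\frac{\ln(d-1)}{\ln 3}-\frac{\ln(\ln 3)}{\ln 3}+\frac12$, and for such $n$ $$\|\mathbb E_L^{(d,n)}\|_\infty^2=\frac{(d+1)^2}{2^{2d-1}}\,\|V_\rho^{(d-1)}(\alpha_n)\|_2^2\ \le\ \frac{(d+1)^2}{3\cdot2^d}\Big(2+(1+3^{-2n})^{d-1}\Big).$$ -/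

import Mathlib

open scoped Matrix BigOperators

noncomputable section

namespace DecoratedAKLT

/-- Matrices on one spin-1/2 particle `ℂ²`; the index `0` is spin up, the index `1` is spin down. -/
abbrev M2 : Type := Matrix (Fin 2) (Fin 2) ℂ

/-- Matrices on `(ℂ²)^{⊗ m}`, in the product basis labelled by `Fin m → Fin 2`. -/
abbrev MTensor (m : ℕ) : Type := Matrix (Fin m → Fin 2) (Fin m → Fin 2) ℂ

section HilbertSchmidt

variable {ι κ : Type*} [Fintype ι] [Fintype κ]

/-- The Hilbert-Schmidt inner product `Tr (A* B)`. -/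
def hsInner (A B : Matrix ι ι ℂ) : ℂ := (Aᴴ * B).trace

/-- The Hilbert-Schmidt norm. -/
def hsNorm (A : Matrix ι ι ℂ) : ℝ := Real.sqrt (hsInner A A).re

/-- The rank-one map `|A⟩⟨B|`, `C ↦ ⟨B, C⟩ A`, for the Hilbert-Schmidt inner product. -/
def hsKetBra (A : Matrix κ κ ℂ) (B : Matrix ι ι ℂ) : Matrix ι ι ℂ →ₗ[ℂ] Matrix κ κ ℂ where
  toFun C := hsInner B C • A
  map_add' C D := by simp [hsInner, Matrix.mul_add, add_smul]
  map_smul' c C := by simp [hsInner, mul_smul]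

/-- The quotients `‖T A‖₂ / ‖A‖₂` for `A ≠ 0`. -/
def hsRatios (T : Matrix ι ι ℂ →ₗ[ℂ] Matrix κ κ ℂ) : Set ℝ :=
  {c | ∃ A : Matrix ι ι ℂ, A ≠ 0 ∧ c = hsNorm (T A) / hsNorm A}

/-- The Schatten-`∞` norm of a linear map between Hilbert-Schmidt spaces. -/
def schattenInf (T : Matrix ι ι ℂ →ₗ[ℂ] Matrix κ κ ℂ) : ℝ := sSup (hsRatios T)

/-- `σ ≥ 0` is a singular value of `T`: `T* T A = σ² A` for some `A ≠ 0`, the adjoint being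
taken for the Hilbert-Schmidt inner products (and written out in weak form). -/
def IsSingularValue (T : Matrix ι ι ℂ →ₗ[ℂ] Matrix κ κ ℂ) (σ : ℝ) : Prop :=
  0 ≤ σ ∧ ∃ A : Matrix ι ι ℂ, A ≠ 0 ∧
    ∀ B : Matrix ι ι ℂ, hsInner (T B) (T A) = (σ : ℂ) ^ 2 * hsInner B A

end HilbertSchmidt

section TensorProducts

/-- The elementary tensor `A₁ ⊗ ⋯ ⊗ A_m`. -/
def elemTensor {m : ℕ} (A : Fin m → M2) : MTensor m :=
  Matrix.of fun x y => ∏ i, A i (x i) (y i)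

theorem elemTensor_mul {m : ℕ} (A B : Fin m → M2) :
    elemTensor A * elemTensor B = elemTensor fun i => A i * B i := by
  ext x y
  simp only [elemTensor, Matrix.mul_apply, Matrix.of_apply, Finset.prod_univ_sum,
    Fintype.piFinset_univ, Finset.prod_mul_distrib]

/-- The `m`-fold tensor power `T^{⊗ m}` of a linear map `T` on `M₂(ℂ)`, through its matrix elements
on matrix units. -/
def mapTensor (m : ℕ) (T : M2 →ₗ[ℂ] M2) : MTensor m →ₗ[ℂ] MTensor m where
  toFun A := ∑ u, ∑ v, A u v • elemTensor fun i => T (Matrix.single (u i) (v i) 1)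
  map_add' A B := by simp [add_smul, Finset.sum_add_distrib]
  map_smul' c A := by simp [mul_smul, Finset.smul_sum]

theorem mapTensor_elemTensor {m : ℕ} (T : M2 →ₗ[ℂ] M2) (A : Fin m → M2) :
    mapTensor m T (elemTensor A) = elemTensor fun i => T (A i) := by
  have key : ∀ i, T (A i) = ∑ q : Fin 2 × Fin 2, A i q.1 q.2 • T (Matrix.single q.1 q.2 1) := by
    intro i
    conv_lhs => rw [Matrix.matrix_eq_sum_single (A i)]
    rw [Fintype.sum_prod_type]
    simp only [map_sum, ← map_smul, Matrix.smul_single, smul_eq_mul, mul_one]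
  ext x y
  simp only [mapTensor, LinearMap.coe_mk, AddHom.coe_mk, elemTensor, Matrix.of_apply, key,
    Matrix.sum_apply, Matrix.smul_apply, smul_eq_mul]
  rw [Finset.prod_univ_sum, Fintype.piFinset_univ, ← Fintype.sum_prod_type']
  refine Fintype.sum_equiv (Equiv.arrowProdEquivProdArrow (Fin m) (fun _ => Fin 2) (fun _ => Fin 2)).symm _ _ ?_
  rintro ⟨u, v⟩
  simp [Equiv.arrowProdEquivProdArrow, Finset.prod_mul_distrib]

end TensorProducts

section Spin

/-- The three Pauli matrices `σ^X, σ^Y, σ^Z`. -/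
def pauli : Fin 3 → M2 :=
  ![!![0, 1; 1, 0], !![0, -Complex.I; Complex.I, 0], !![1, 0; 0, -1]]

/-- The spin matrices `S^U = σ^U / 2`. -/
def spin (U : Fin 3) : M2 := (1 / 2 : ℂ) • pauli U

/-- The maximally mixed state `ρ = 1 / 2`. -/
def rho : M2 := (1 / 2 : ℂ) • (1 : M2)

/-- The spin-1 AKLT transfer operator `|1⟩⟨ρ| - (1/3) ∑_U |σ^U⟩⟨S^U|`. -/
def transferE : M2 →ₗ[ℂ] M2 :=
  hsKetBra 1 rho - (1 / 3 : ℂ) • ∑ U : Fin 3, hsKetBra (pauli U) (spin U)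

end Spin

section Matchings

/-- `p` is an `r`-matching of an `m`-element set: a collection of `r` pairwise disjoint unordered
pairs. -/
def IsMatching (m r : ℕ) (p : Finset (Finset (Fin m))) : Prop :=
  p.card = r ∧ (∀ e ∈ p, e.card = 2) ∧ (p : Set (Finset (Fin m))).PairwiseDisjoint id

/-- For `e = {i, j}` with `i ≠ j`, the operator `𝐒_i · 𝐒_j = ∑_U S_i^U S_j^U`. -/
def heis {m : ℕ} (e : Finset (Fin m)) : MTensor m :=
  ∑ U : Fin 3, elemTensor fun i => if i ∈ e then spin U else 1

theorem heis_commute {m : ℕ} {e f : Finset (Fin m)} (h : Disjoint e f) :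
    Commute (heis e) (heis f) := by
  unfold heis
  refine Commute.sum_left _ _ _ fun U _ => Commute.sum_right _ _ _ fun W _ => ?_
  unfold Commute SemiconjBy
  rw [elemTensor_mul, elemTensor_mul]
  congr 1
  funext i
  by_cases he : i ∈ e
  · have hf : i ∉ f := Finset.disjoint_left.mp h he
    simp [he, hf]
  · simp [he]

/-- `S_p = ∏_{(i,j) ∈ p} 𝐒_i · 𝐒_j`; the factors commute. -/
def matchingTerm {m r : ℕ} (p : {p : Finset (Finset (Fin m)) // IsMatching m r p}) : MTensor m :=
  p.1.noncommProd heis fun _ he _ hf hne => heis_commute (p.2.2.2 he hf hne)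

open Classical in
/-- The matching operator `M_r^{(m)} = ∑_p S_p`, over all `r`-matchings `p`. -/
def matchingOp (m r : ℕ) : MTensor m :=
  ∑ p : {p : Finset (Finset (Fin m)) // IsMatching m r p}, matchingTerm p

/-- `V_ρ^{(m)}(α) = ∑_{r = 0}^{⌊m/2⌋} α^{2r} / (2r+1)!! M_r^{(m)}`. -/
def Vrho (m : ℕ) (α : ℂ) : MTensor m :=
  ∑ r ∈ Finset.range (m / 2 + 1),
    (α ^ (2 * r) / (Nat.doubleFactorial (2 * r + 1) : ℂ)) • matchingOp m r

/-- `α_n = 2 (-1/3)^n`. -/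
def alpha (n : ℕ) : ℂ := 2 * (-1 / 3) ^ n

end Matchings

section TransferOperators

/-- The basis vector `|↑⟩`. -/
def ketUp : Fin 2 → ℂ := ![1, 0]

/-- The basis vector `|↓⟩`. -/
def ketDown : Fin 2 → ℂ := ![0, 1]

/-- The normalized symmetric vector in `(ℂ²)^{⊗ m}` with `k` up spins: equal weight on all
`m.choose k` product vectors with `k` up spins (and zero if `k > m`). -/
def symVec (m k : ℕ) : (Fin m → Fin 2) → ℂ := fun x =>
  if (Finset.univ.filter fun i => x i = 0).card = k then
    ((1 / Real.sqrt (m.choose k : ℝ) : ℝ) : ℂ) else 0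

/-- The singlet tensor `K = |↑⟩⟨↓| - |↓⟩⟨↑|`. -/
def singletK : M2 :=
  Matrix.vecMulVec ketUp (star ketDown) - Matrix.vecMulVec ketDown (star ketUp)

/-- `V_k^d = ((d-k)/d)^{1/2} |↓⟩⟨φ_k^{d-1}| + (k/d)^{1/2} |↑⟩⟨φ_{k-1}^{d-1}|`, for `0 ≤ k ≤ d`
(for `k = 0` the second coefficient vanishes). -/
def Vtensor (d k : ℕ) : Matrix (Fin 2) (Fin (d - 1) → Fin 2) ℂ :=
  ((Real.sqrt (((d : ℝ) - k) / d) : ℝ) : ℂ) •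
      Matrix.vecMulVec ketDown (star (symVec (d - 1) k)) +
    ((Real.sqrt ((k : ℝ) / d) : ℝ) : ℂ) •
      Matrix.vecMulVec ketUp (star (symVec (d - 1) (k - 1)))

/-- `W_k^d = K V_k^d`. -/
def Wtensor (d k : ℕ) : Matrix (Fin 2) (Fin (d - 1) → Fin 2) ℂ := singletK * Vtensor d k

/-- The undecorated transfer operator `B ↦ ∑_{k=0}^d (W_k^d)* B W_k^d`. -/
def ELzero (d : ℕ) : M2 →ₗ[ℂ] MTensor (d - 1) where
  toFun B := ∑ k ∈ Finset.range (d + 1), (Wtensor d k)ᴴ * B * Wtensor d k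
  map_add' A B := by simp [Matrix.mul_add, Matrix.add_mul, Finset.sum_add_distrib]
  map_smul' c A := by simp [Finset.smul_sum]

/-- The decorated transfer operator `(𝔼^{⊗ (d-1)})^n ∘ 𝔼_L^{(d,0)}`. -/
def EL (d n : ℕ) : M2 →ₗ[ℂ] MTensor (d - 1) :=
  ((mapTensor (d - 1) transferE) ^ n) ∘ₗ ELzero d

/-- `Q_L^{(d,n)} = 𝔼_L^{(d,n)}(1)`. -/
def QL (d n : ℕ) : MTensor (d - 1) := EL d n 1

/-- The real eigenvalues of `Q_L^{(d,n)}`. -/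
def QLeigenvalues (d n : ℕ) : Set ℝ :=
  {x | Module.End.HasEigenvalue (Matrix.toLin' (QL d n)) (x : ℂ)}

/-- The minimal eigenvalue of `Q_L^{(d,n)}`. -/
def qL (d n : ℕ) : ℝ := sInf (QLeigenvalues d n)

end TransferOperators

end DecoratedAKLT

end

noncomputable section

namespace DecoratedAKLT

/-! ### Elementary tensors and tensor powers of linear maps -/

section ElementaryTensors

variable {m : ℕ}

/-! The transfer operator `transferE` is the depolarizing map `B ↦ τ B + (1 - τ) (Tr B / 2) 1` with
`τ = -1/3`, so its `n`-th power is the depolarizing map with parameter `τ ^ n`. Put `m = d - 1`. In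
`∑ W* W` the unitary `K` cancels, leaving `(m+2)/(m+1)` times the projection `P` onto the symmetric
subspace of `m` spins. Everything therefore rests on the depolarized `P`.

The key identity is `mapTensor_depol_symProj`: depolarizing `P` gives `(m+1)/2^m · V_ρ(2τ)`. Both
sides are permutation invariant, so by polarization it suffices to pair them with `A^{⊗m}`. The
pairing with `P` is the trace of a symmetric power, a complete homogeneous sum in the eigenvalues
`Tr A / 2 ± τ s`, where `s² = ∑ (Tr S^U A)²`. On the other side each `r`-matching contributes
`s^{2r} (Tr A)^{m-2r}`, and the number of matchings divided by `(2r+1)!!` is `C(m,2r)/(2r+1)`. The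
two expansions agree.

For the eigenvalue bound, `‖S_i · S_j‖ ≤ 3/4` makes `V_ρ - 1` small in operator norm
(`norm_Vrho_sub_one_le`). The bound is positive once `(1+u)^m ≤ e^{mu} ≤ 3` with `u = 3^{-n+1/2}`,
which gives invertibility.

For the norm, let `T` be the adjoint of `EL` composed with `EL`. It has the form `B ↦ ∑ L B L*` with
a family `L` closed under adjoints, and `T 1 = c · 1`. Hence `∑ L L* = ∑ L* L = c`, which forces `T
≤ c` on all matrices, not only Hermitian ones. So `1` is a maximizer and `c = ‖Q_L‖₂² / 2`. -/

theorem single_eq_elemTensor (u v : Fin m → Fin 2) :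
    (Matrix.single u v 1 : MTensor m) = elemTensor fun i => Matrix.single (u i) (v i) 1 := by
  ext x y
  simp only [elemTensor, Matrix.of_apply, Matrix.single_apply]
  by_cases h : u = x ∧ v = y
  · obtain ⟨rfl, rfl⟩ := h
    simp
  · rw [if_neg h]
    symm
    by_contra hne
    refine h ⟨?_, ?_⟩ <;> funext i <;>
    · have := Finset.prod_ne_zero_iff.mp hne i (Finset.mem_univ i)
      by_contra hi
      simp [hi] at this

/-- Matrix units are elementary tensors, so elementary tensors span. Identities between tensor
powers thereby reduce to a single factor. -/
theorem linearMap_ext_elemTensor {N : Type*} [AddCommMonoid N] [Module ℂ N]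
    {f g : MTensor m →ₗ[ℂ] N} (h : ∀ A, f (elemTensor A) = g (elemTensor A)) : f = g := by
  refine LinearMap.ext fun X => ?_
  rw [Matrix.matrix_eq_sum_single X]
  simp only [map_sum]
  refine Finset.sum_congr rfl fun u _ => Finset.sum_congr rfl fun v _ => ?_
  rw [← mul_one (X u v), ← smul_eq_mul, ← Matrix.smul_single, map_smul, map_smul,
    single_eq_elemTensor, h]

theorem trace_elemTensor (A : Fin m → M2) : (elemTensor A).trace = ∏ i, (A i).trace := by
  simp only [Matrix.trace, Matrix.diag, elemTensor, Matrix.of_apply]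
  rw [Finset.prod_univ_sum, Fintype.piFinset_univ]

theorem trace_mul_elemTensor (X : MTensor m) (A : Fin m → M2) :
    (X * elemTensor A).trace = ∑ x, ∑ y, X x y * ∏ i, A i (y i) (x i) := by
  simp [Matrix.trace, Matrix.mul_apply, elemTensor]

theorem elemTensor_one : elemTensor (fun _ : Fin m => (1 : M2)) = 1 := by
  ext x y
  simp only [elemTensor, Matrix.of_apply, Matrix.one_apply]
  by_cases h : x = y
  · simp [h]
  · rw [if_neg h]
    obtain ⟨i, hi⟩ := Function.ne_iff.mp h
    exact Finset.prod_eq_zero (Finset.mem_univ i) (by simp [hi])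

theorem conjTranspose_elemTensor (A : Fin m → M2) :
    (elemTensor A)ᴴ = elemTensor fun i => (A i)ᴴ := by
  ext x y
  simp [elemTensor, Matrix.conjTranspose_apply]

theorem elemTensor_smul (c : Fin m → ℂ) (A : Fin m → M2) :
    (elemTensor fun i => c i • A i) = (∏ i, c i) • elemTensor A := by
  ext x y
  simp [elemTensor, Finset.prod_mul_distrib]

theorem elemTensor_sum {κ : Type*} [Fintype κ] [DecidableEq κ] (A : Fin m → κ → M2) :
    (elemTensor fun i => ∑ j, A i j) = ∑ s : Fin m → κ, elemTensor fun i => A i (s i) := by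
  ext x y
  simp only [elemTensor, Matrix.of_apply, Matrix.sum_apply]
  rw [Finset.prod_univ_sum, Fintype.piFinset_univ]

theorem mapTensor_comp (S T : M2 →ₗ[ℂ] M2) :
    mapTensor m S ∘ₗ mapTensor m T = mapTensor m (S ∘ₗ T) :=
  linearMap_ext_elemTensor fun A => by simp [mapTensor_elemTensor]

theorem mapTensor_id : mapTensor m LinearMap.id = LinearMap.id :=
  linearMap_ext_elemTensor fun A => by simp [mapTensor_elemTensor]

theorem mapTensor_pow (T : M2 →ₗ[ℂ] M2) (n : ℕ) : mapTensor m T ^ n = mapTensor m (T ^ n) := by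
  induction n with
  | zero => exact mapTensor_id.symm
  | succ n ih =>
    rw [pow_succ, pow_succ, ih]
    exact mapTensor_comp _ _

theorem trace_mapTensor_mul {T : M2 →ₗ[ℂ] M2}
    (hT : ∀ A B, (T A * B).trace = (A * T B).trace) (X Y : MTensor m) :
    (mapTensor m T X * Y).trace = (X * mapTensor m T Y).trace := by
  have h : (LinearMap.mul ℂ (MTensor m)).compr₂ (Matrix.traceLinearMap _ ℂ ℂ) ∘ₗ mapTensor m T =
      ((LinearMap.mul ℂ (MTensor m)).compr₂ (Matrix.traceLinearMap _ ℂ ℂ)).compl₂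
        (mapTensor m T) := by
    refine linearMap_ext_elemTensor fun A => linearMap_ext_elemTensor fun B => ?_
    simp [mapTensor_elemTensor, elemTensor_mul, trace_elemTensor, hT]
  simpa using LinearMap.congr_fun (LinearMap.congr_fun h X) Y

theorem conjTranspose_mapTensor {T : M2 →ₗ[ℂ] M2} (hT : ∀ A, (T A)ᴴ = T Aᴴ) (X : MTensor m) :
    (mapTensor m T X)ᴴ = mapTensor m T Xᴴ := by
  simp only [mapTensor, LinearMap.coe_mk, AddHom.coe_mk, Matrix.conjTranspose_sum,
    Matrix.conjTranspose_smul, conjTranspose_elemTensor, hT, Matrix.conjTranspose_single, star_one,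
    Matrix.conjTranspose_apply]
  exact Finset.sum_comm

theorem hsInner_mapTensor {T : M2 →ₗ[ℂ] M2} (hT : ∀ A B, (T A * B).trace = (A * T B).trace)
    (hT' : ∀ A, (T A)ᴴ = T Aᴴ) (X Y : MTensor m) :
    hsInner (mapTensor m T X) Y = hsInner X (mapTensor m T Y) := by
  rw [hsInner, conjTranspose_mapTensor hT', trace_mapTensor_mul hT, hsInner]

/-- Tensor products of Kraus operators are Kraus operators of the tensor power. This is how
positivity of the one-spin map reaches the norm bound. -/
theorem mapTensor_kraus {κ : Type*} [Fintype κ] [DecidableEq κ] {T : M2 →ₗ[ℂ] M2} (R : κ → M2)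
    (hT : ∀ A, T A = ∑ j, R j * A * R j) (X : MTensor m) :
    mapTensor m T X = ∑ s : Fin m → κ,
      (elemTensor fun i => R (s i)) * X * elemTensor fun i => R (s i) := by
  have h : mapTensor m T = ∑ s : Fin m → κ,
      LinearMap.mulLeftRight ℂ (elemTensor fun i => R (s i), elemTensor fun i => R (s i)) := by
    refine linearMap_ext_elemTensor fun A => ?_
    simp only [mapTensor_elemTensor, hT, elemTensor_sum, LinearMap.sum_apply,
      LinearMap.mulLeftRight_apply, elemTensor_mul]
  simp [h, LinearMap.sum_apply]

end ElementaryTensors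

/-! ### The depolarizing semigroup on one spin -/

section Depolarizing

/-- The map `B ↦ τ B + (1 - τ) (Tr B / 2) 1` on `M₂(ℂ)`. -/
def depol (τ : ℂ) : M2 →ₗ[ℂ] M2 :=
  τ • LinearMap.id + ((1 - τ) / 2) • (Matrix.traceLinearMap (Fin 2) ℂ ℂ).smulRight (1 : M2)

theorem depol_apply (τ : ℂ) (A : M2) : depol τ A = τ • A + ((1 - τ) / 2 * A.trace) • (1 : M2) := by
  simp [depol, smul_smul]

theorem trace_depol (τ : ℂ) (A : M2) : (depol τ A).trace = A.trace := by
  simp [depol_apply]; ring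

theorem depol_comp (τ υ : ℂ) : depol τ ∘ₗ depol υ = depol (τ * υ) := by
  refine LinearMap.ext fun A => ?_
  rw [LinearMap.comp_apply, depol_apply τ, trace_depol, depol_apply, depol_apply, smul_add,
    smul_smul, smul_smul, add_assoc, ← add_smul]
  congr 2
  ring

theorem depol_one : depol 1 = LinearMap.id := by
  refine LinearMap.ext fun A => ?_
  simp [depol_apply]

theorem depol_pow (τ : ℂ) (n : ℕ) : depol τ ^ n = depol (τ ^ n) := by
  induction n with
  | zero => rw [pow_zero, pow_zero, depol_one]; rfl
  | succ n ih =>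
    rw [pow_succ, pow_succ, ih]
    exact depol_comp _ _

/-- Both maps fix `1` and multiply each Pauli matrix by `-1/3`, because `Tr (S^U σ^W)` is the
Kronecker delta. -/
theorem transferE_eq_depol : transferE = depol (-1 / 3) := by
  refine LinearMap.ext fun A => ?_
  ext i j
  fin_cases i <;> fin_cases j <;>
    simp [depol_apply, transferE, hsKetBra, hsInner, rho, spin, pauli, Fin.sum_univ_three,
      Matrix.trace_fin_two, Matrix.mul_apply, Fin.sum_univ_two] <;> ring_nf <;> simp <;> ring

theorem trace_depol_mul (τ : ℂ) (A B : M2) : (depol τ A * B).trace = (A * depol τ B).trace := by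
  simp [depol_apply, add_mul, mul_add]; ring

theorem conjTranspose_depol {τ : ℂ} (hτ : star τ = τ) (A : M2) : (depol τ A)ᴴ = depol τ Aᴴ := by
  simp [depol_apply, Matrix.conjTranspose_add, Matrix.conjTranspose_smul, hτ,
    Matrix.trace_conjTranspose]

/-- Depolarizing keeps the mean of the two eigenvalues and scales their distance from it by `τ`. -/
theorem det_depol (τ : ℂ) (A : M2) :
    (depol τ A).det = (A.trace / 2) ^ 2 - τ ^ 2 * ((A.trace / 2) ^ 2 - A.det) := by
  simp [depol_apply, Matrix.det_fin_two, Matrix.trace_fin_two]; ring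

/-- Hermitian Kraus operators of `depol τ` for `0 ≤ τ ≤ 1`. -/
def depolKraus (τ : ℝ) : Option (Fin 3) → M2
  | none => ((Real.sqrt ((1 + 3 * τ) / 4) : ℝ) : ℂ) • 1
  | some U => ((Real.sqrt ((1 - τ) / 4) : ℝ) : ℂ) • pauli U

theorem pauli_isHermitian (U : Fin 3) : (pauli U)ᴴ = pauli U := by
  ext i j
  fin_cases U <;> fin_cases i <;> fin_cases j <;> simp [pauli]

theorem pauli_mul_self (U : Fin 3) : pauli U * pauli U = 1 := by
  ext i j
  fin_cases U <;> fin_cases i <;> fin_cases j <;>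
    simp [pauli, Matrix.mul_apply, Fin.sum_univ_two]

theorem depolKraus_isHermitian (τ : ℝ) (j : Option (Fin 3)) :
    (depolKraus τ j)ᴴ = depolKraus τ j := by
  cases j <;> simp [depolKraus, pauli_isHermitian]

theorem sum_pauli_conj (A : M2) :
    ∑ U, pauli U * A * pauli U = (2 * A.trace) • (1 : M2) - A := by
  rw [Matrix.eta_fin_two A]
  ext i j
  fin_cases i <;> fin_cases j <;>
    simp [Fin.sum_univ_three, pauli, Matrix.trace_fin_two, mul_right_comm Complex.I] <;>
    ring

theorem depol_kraus {τ : ℝ} (h0 : 0 ≤ τ) (h1 : τ ≤ 1) (A : M2) :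
    depol τ A = ∑ j, depolKraus τ j * A * depolKraus τ j := by
  have hp : ((Real.sqrt ((1 + 3 * τ) / 4) : ℝ) : ℂ) * ((Real.sqrt ((1 + 3 * τ) / 4) : ℝ) : ℂ) =
      (1 + 3 * τ) / 4 := by
    rw [← Complex.ofReal_mul, Real.mul_self_sqrt (by linarith)]; push_cast; ring
  have hq : ((Real.sqrt ((1 - τ) / 4) : ℝ) : ℂ) * ((Real.sqrt ((1 - τ) / 4) : ℝ) : ℂ) =
      (1 - τ) / 4 := by
    rw [← Complex.ofReal_mul, Real.mul_self_sqrt (by linarith)]; push_cast; ring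
  simp only [Fintype.sum_option, depolKraus, smul_mul_assoc, mul_smul_comm, smul_smul, hp, hq,
    ← Finset.smul_sum, sum_pauli_conj, one_mul, mul_one, depol_apply]
  module

end Depolarizing

/-! ### Traces of symmetric powers -/

section SymmetricPower

open Polynomial

/-- The number of up spins of a product basis vector. -/
def upCount {m : ℕ} (x : Fin m → Fin 2) : ℕ := (Finset.univ.filter fun i => x i = 0).card

theorem upCount_le {m : ℕ} (x : Fin m → Fin 2) : upCount x ≤ m :=
  (Finset.card_filter_le _ _).trans (by simp)

theorem upCount_comp_perm {m : ℕ} (x : Fin m → Fin 2) (σ : Equiv.Perm (Fin m)) :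
    upCount (x ∘ σ) = upCount x := by
  unfold upCount
  refine Finset.card_bij (fun i _ => σ i) (by simp) (by simp) fun j hj => ⟨σ.symm j, ?_⟩
  simpa using hj

theorem sum_upCount_eq_coeff {m : ℕ} (f : Fin m → Fin 2 → ℂ) (k : ℕ) :
    ∑ x : Fin m → Fin 2, (if upCount x = k then ∏ i, f i (x i) else 0) =
      (∏ i, (C (f i 0) * X + C (f i 1))).coeff k := by
  have h : ∀ i, C (f i 0) * X + C (f i 1) =
      ∑ b : Fin 2, C (f i b) * X ^ (if b = 0 then 1 else 0) := by
    intro i; simp [Fin.sum_univ_two]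
  simp only [h]
  rw [Finset.prod_univ_sum, Fintype.piFinset_univ, finsetSum_coeff]
  refine Finset.sum_congr rfl fun x _ => ?_
  rw [Finset.prod_mul_distrib, Finset.prod_pow_eq_pow_sum, ← map_prod, coeff_C_mul_X_pow, upCount,
    Finset.card_filter]
  simp only [eq_comm]

theorem prod_eq_pow_upCount {m : ℕ} {R : Type*} [CommMonoid R] (f : Fin 2 → R)
    (x : Fin m → Fin 2) : ∏ i, f (x i) = f 0 ^ upCount x * f 1 ^ (m - upCount x) := by
  have h : ∀ i, f (x i) = if x i = 0 then f 0 else f 1 := by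
    intro i
    generalize x i = b
    fin_cases b <;> simp
  have hc := Finset.card_filter_add_card_filter_not (s := (Finset.univ : Finset (Fin m)))
    (fun i => x i = 0)
  rw [Finset.card_univ, Fintype.card_fin] at hc
  simp only [h]
  rw [Finset.prod_ite, Finset.prod_const, Finset.prod_const, upCount]
  congr 2
  omega

theorem sum_upCount (m : ℕ) (F : ℕ → ℂ) :
    ∑ x : Fin m → Fin 2, F (upCount x) = ∑ k ∈ Finset.range (m + 1), (m.choose k : ℂ) * F k := by
  have h : ∀ k, (m.choose k : ℂ) * F k =
      ∑ x : Fin m → Fin 2, if upCount x = k then F k else 0 := by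
    intro k
    have := sum_upCount_eq_coeff (fun (_ : Fin m) _ => (1 : ℂ)) k
    simp only [map_one, one_mul, Finset.prod_const, Finset.card_univ, Fintype.card_fin,
      coeff_X_add_one_pow] at this
    rw [← this, Finset.sum_mul]
    refine Finset.sum_congr rfl fun x _ => ?_
    split_ifs <;> simp
  simp only [h]
  rw [Finset.sum_comm]
  refine Finset.sum_congr rfl fun x _ => ?_
  rw [Finset.sum_ite_eq, if_pos (Finset.mem_range_succ_iff.mpr (upCount_le x))]

/-- The projection onto the symmetric subspace of `(ℂ²)^{⊗ m}`. -/
def symProj (m : ℕ) : MTensor m :=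
  Matrix.of fun x y => if upCount x = upCount y then (1 / (m.choose (upCount y) : ℂ)) else 0

/-- The trace of the `m`-th symmetric power of a `2 × 2` matrix. -/
def symTrace (m : ℕ) (A : M2) : ℂ :=
  ∑ k ∈ Finset.range (m + 1),
    ((C (A 0 0) * X + C (A 0 1)) ^ k * (C (A 1 0) * X + C (A 1 1)) ^ (m - k)).coeff k

theorem trace_symProj_mul (m : ℕ) (A : M2) :
    (symProj m * elemTensor fun _ => A).trace = symTrace m A := by
  rw [trace_mul_elemTensor, Finset.sum_comm]
  -- Row `y i` of `A` becomes a linear polynomial in which `X` marks an up spin of `x`; extracting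
  -- the coefficient at `upCount y` enforces equal spin counts.
  have h : ∀ y : Fin m → Fin 2, ∑ x, symProj m x y * ∏ i, A (y i) (x i) =
      (1 / (m.choose (upCount y) : ℂ)) * ((C (A 0 0) * X + C (A 0 1)) ^ upCount y *
        (C (A 1 0) * X + C (A 1 1)) ^ (m - upCount y)).coeff (upCount y) := by
    intro y
    rw [← prod_eq_pow_upCount (fun b => C (A b 0) * X + C (A b 1)) y,
      ← sum_upCount_eq_coeff (fun i => A (y i)), Finset.mul_sum]
    refine Finset.sum_congr rfl fun x _ => ?_
    simp only [symProj, Matrix.of_apply]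
    split_ifs <;> simp
  simp only [h]
  refine (sum_upCount m fun k => (1 / (m.choose k : ℂ)) * ((C (A 0 0) * X + C (A 0 1)) ^ k *
        (C (A 1 0) * X + C (A 1 1)) ^ (m - k)).coeff k).trans ?_
  refine Finset.sum_congr rfl fun k hk => ?_
  have : (m.choose k : ℂ) ≠ 0 := by
    exact_mod_cast (Nat.choose_pos (Finset.mem_range_succ_iff.mp hk)).ne'
  field_simp

theorem coeff_succ_linear_mul (a b : ℂ) (p : ℂ[X]) (k : ℕ) :
    ((C a * X + C b) * p).coeff (k + 1) = a * p.coeff k + b * p.coeff (k + 1) := by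
  rw [add_mul, mul_assoc, coeff_add, coeff_C_mul, coeff_C_mul, coeff_X_mul]

/-- The recursion of complete homogeneous symmetric polynomials in two eigenvalues, obtained without
diagonalizing `A`. -/
theorem symTrace_add_two (m : ℕ) (A : M2) :
    symTrace (m + 2) A = A.trace * symTrace (m + 1) A - A.det * symTrace m A := by
  set u : ℂ[X] := C (A 0 0) * X + C (A 0 1) with hu
  set v : ℂ[X] := C (A 1 0) * X + C (A 1 1) with hv
  -- The neighbouring coefficients close the recursion: splitting off a factor `u` expresses
  -- `symTrace` through `o`, splitting off `v` expresses `o` through `symTrace`.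
  let o : ℕ → ℂ := fun m => ∑ k ∈ Finset.range (m + 1), (u ^ k * v ^ (m - k)).coeff (k + 1)
  have ht : ∀ m, symTrace (m + 1) A =
      A 1 1 ^ (m + 1) + A 0 0 * symTrace m A + A 0 1 * o m := by
    intro m
    rw [symTrace, Finset.sum_range_succ', ← hu, ← hv]
    have h0 : (u ^ 0 * v ^ (m + 1 - 0)).coeff 0 = A 1 1 ^ (m + 1) := by
      simp [hv, coeff_zero_eq_eval_zero]
    rw [h0, add_comm, add_assoc, symTrace, Finset.mul_sum, Finset.mul_sum, ← Finset.sum_add_distrib]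
    congr 1
    refine Finset.sum_congr rfl fun k _ => ?_
    rw [pow_succ', mul_assoc, hu, coeff_succ_linear_mul, Nat.add_sub_add_right]
  have ho : ∀ m, o (m + 1) = A 1 0 * symTrace m A + A 1 1 * o m := by
    intro m
    have hlast : (u ^ (m + 1) * v ^ (m + 1 - (m + 1))).coeff (m + 1 + 1) = 0 := by
      rw [Nat.sub_self, pow_zero, mul_one]
      refine coeff_eq_zero_of_natDegree_lt (lt_of_le_of_lt (natDegree_pow_le_of_le (m + 1)
        (natDegree_linear_le (a := A 0 0) (b := A 0 1))) ?_)
      omega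
    simp only [o]
    rw [Finset.sum_range_succ, hlast, add_zero, symTrace, Finset.mul_sum, Finset.mul_sum,
      ← Finset.sum_add_distrib]
    refine Finset.sum_congr rfl fun k hk => ?_
    rw [Nat.succ_sub (Finset.mem_range_succ_iff.mp hk), pow_succ', mul_left_comm,
      hv, coeff_succ_linear_mul]
  have h1 := ht (m + 1)
  rw [ho] at h1
  rw [h1, Matrix.trace_fin_two, Matrix.det_fin_two]
  linear_combination (-(A 1 1)) * ht m

theorem symTrace_eq_sum (m : ℕ) (A : M2) {α β : ℂ} (h1 : α + β = A.trace) (h2 : α * β = A.det) :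
    symTrace m A = ∑ i ∈ Finset.range (m + 1), α ^ i * β ^ (m - i) := by
  have hg : ∀ n, ∑ i ∈ Finset.range (n + 2), α ^ i * β ^ (n + 1 - i) =
      β * ∑ i ∈ Finset.range (n + 1), α ^ i * β ^ (n - i) + α ^ (n + 1) := by
    intro n
    rw [Finset.sum_range_succ, Nat.sub_self, pow_zero, mul_one, Finset.mul_sum]
    congr 1
    refine Finset.sum_congr rfl fun k hk => ?_
    rw [Nat.succ_sub (Finset.mem_range_succ_iff.mp hk), pow_succ]
    ring
  have h0 : symTrace 0 A = 1 := by simp [symTrace]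
  have h1' : symTrace 1 A = α + β := by
    rw [h1, symTrace, Matrix.trace_fin_two]
    simp [Finset.sum_range_succ, coeff_X_zero, add_comm]
  induction m using Nat.twoStepInduction with
  | zero => simp [h0]
  | one => simp [Finset.sum_range_succ, h1', add_comm]
  | more n ih1 ih2 =>
    rw [symTrace_add_two, ih1, ih2, hg (n + 1), hg n, ← h1, ← h2]
    ring

theorem sum_range_two_mul (F : ℕ → ℂ) (k : ℕ) :
    ∑ j ∈ Finset.range (2 * k), F j = ∑ r ∈ Finset.range k, (F (2 * r) + F (2 * r + 1)) := by
  induction k with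
  | zero => simp
  | succ k ih =>
    rw [show 2 * (k + 1) = 2 * k + 1 + 1 by ring, Finset.sum_range_succ, Finset.sum_range_succ, ih,
      Finset.sum_range_succ]
    ring

/-- Times `2u`, the left side telescopes to `(a+u)^{m+1} - (a-u)^{m+1}`. Only odd powers of `u`
survive, and `C(m+1,2r+1) = (m+1)/(2r+1) · C(m,2r)`. Cancelling `2u` makes `u = 0` a separate case.
-/
theorem sum_pow_add_mul_pow_sub (m : ℕ) (a u : ℂ) :
    ∑ i ∈ Finset.range (m + 1), (a + u) ^ i * (a - u) ^ (m - i) =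
      ((m : ℂ) + 1) * ∑ r ∈ Finset.range (m / 2 + 1),
        (m.choose (2 * r) : ℂ) / (2 * r + 1) * u ^ (2 * r) * a ^ (m - 2 * r) := by
  by_cases hu : u = 0
  · subst hu
    have h1 : ∀ i ∈ Finset.range (m + 1), (a + 0) ^ i * (a - 0) ^ (m - i) = a ^ m := by
      intro i hi
      rw [add_zero, sub_zero, ← pow_add, Nat.add_sub_cancel' (Finset.mem_range_succ_iff.mp hi)]
    have h2 : ∀ r ∈ Finset.range (m / 2), (m.choose (2 * (r + 1)) : ℂ) / (2 * ((r + 1 : ℕ) : ℂ) + 1) *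
        0 ^ (2 * (r + 1)) * a ^ (m - 2 * (r + 1)) = 0 := by
      intro r _
      rw [zero_pow (by omega)]
      ring
    rw [Finset.sum_congr rfl h1, Finset.sum_range_succ' _ (m / 2), Finset.sum_eq_zero h2]
    simp
  · have h2u : (2 * u : ℂ) ≠ 0 := by simpa using hu
    refine mul_right_cancel₀ h2u ?_
    have hg := (Commute.all (a + u) (a - u)).geom_sum₂_mul (m + 1)
    simp only [Nat.add_sub_cancel] at hg
    rw [show (2 * u : ℂ) = a + u - (a - u) by ring, hg]
    let F : ℕ → ℂ := fun j => (1 - (-1) ^ j) * ((m + 1).choose j * u ^ j * a ^ (m + 1 - j))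
    have hF : (a + u) ^ (m + 1) - (a - u) ^ (m + 1) = ∑ j ∈ Finset.range (m + 1 + 1), F j := by
      rw [add_comm a u, sub_eq_add_neg a u, add_comm a (-u), add_pow, add_pow,
        ← Finset.sum_sub_distrib]
      refine Finset.sum_congr rfl fun j _ => ?_
      simp only [F]
      rw [neg_pow u j]
      ring
    have he : ∀ r, F (2 * r) = 0 := by intro r; simp [F, pow_mul]
    -- For odd `m` the two ranges differ by the last index, which is even and contributes zero.
    have hsum : ∑ j ∈ Finset.range (m + 1 + 1), F j =
        ∑ j ∈ Finset.range (2 * (m / 2 + 1)), F j := by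
      rcases Nat.even_or_odd' m with ⟨c, rfl | rfl⟩
      · congr 2; omega
      · rw [Finset.sum_range_succ, show 2 * c + 1 + 1 = 2 * (c + 1) by ring, he, add_zero]
        congr 2; omega
    rw [hF, hsum, sum_range_two_mul, Finset.mul_sum, Finset.sum_mul]
    refine Finset.sum_congr rfl fun r _ => ?_
    rw [he, zero_add]
    have hc : ((m + 1).choose (2 * r + 1) : ℂ) * (2 * r + 1) = (m + 1) * m.choose (2 * r) := by
      exact_mod_cast (Nat.add_one_mul_choose_eq m (2 * r)).symm
    have h0 : (2 * (r : ℂ) + 1) ≠ 0 := by exact_mod_cast Nat.succ_ne_zero (2 * r)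
    simp only [F]
    rw [Nat.add_sub_add_right, Odd.neg_one_pow ⟨r, rfl⟩, eq_div_of_mul_eq h0 hc]
    ring

end SymmetricPower

/-! ### Polarization of permutation-invariant tensors -/

section Polarization

/-- A symmetric tensor vanishes if its polynomial does. -/
theorem eq_zero_of_symmetric {m : ℕ} {κ : Type*} [Fintype κ] [DecidableEq κ]
    {g : (Fin m → κ) → ℂ} (hsym : ∀ (σ : Equiv.Perm (Fin m)) f, g (f ∘ σ) = g f)
    (h : ∀ a : κ → ℂ, ∑ f, g f * ∏ i, a (f i) = 0) : g = 0 := by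
  let D : (Fin m → κ) → κ →₀ ℕ := fun f => ∑ i, Finsupp.single (f i) 1
  have hD : ∀ f k, D f k = (Finset.univ.filter fun i => f i = k).card := by
    intro f k
    rw [Finset.card_filter, Finsupp.finsetSum_apply]
    simp only [Finsupp.single_apply]
  have hperm : ∀ f f', D f = D f' → g f = g f' := by
    intro f f' hff
    have hcard : ∀ k, Nonempty ({i // f i = k} ≃ {i // f' i = k}) := by
      intro k
      refine ⟨Fintype.equivOfCardEq ?_⟩
      rw [Fintype.card_subtype, Fintype.card_subtype, ← hD, ← hD, hff]
    let e := fun k => Classical.choice (hcard k)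
    let σ : Equiv.Perm (Fin m) := Equiv.ofFiberEquiv e
    have : f = f' ∘ σ := funext fun i => (Equiv.ofFiberEquiv_map e i).symm
    rw [this, hsym]
  -- Its coefficient at an occupation vector `D f₀` is `g f₀` times the number of index maps with
  -- that occupation, a positive integer; a polynomial vanishing everywhere on `ℂ` is zero.
  let p : MvPolynomial κ ℂ := ∑ f, MvPolynomial.monomial (D f) (g f)
  have hp : p = 0 := by
    refine MvPolynomial.funext fun a => ?_
    rw [map_zero, ← h a, map_sum]
    refine Finset.sum_congr rfl fun f _ => ?_
    rw [MvPolynomial.eval_monomial]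
    congr 1
    rw [Finsupp.prod_fintype _ _ (by simp)]
    simp only [hD]
    rw [← Finset.prod_fiberwise' Finset.univ f a]
    exact Finset.prod_congr rfl fun k _ => by simp
  funext f₀
  have hc := congrArg (MvPolynomial.coeff (D f₀)) hp
  rw [MvPolynomial.coeff_zero, MvPolynomial.coeff_sum] at hc
  simp only [MvPolynomial.coeff_monomial] at hc
  have hc' : ∑ f, (if D f = D f₀ then g f else 0) = ∑ f, if D f = D f₀ then g f₀ else 0 :=
    Finset.sum_congr rfl fun f _ => by
      split_ifs with hf
      · exact hperm _ _ hf
      · rfl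
  rw [hc', ← Finset.sum_filter, Finset.sum_const, nsmul_eq_mul, mul_eq_zero] at hc
  refine hc.resolve_left ?_
  exact_mod_cast (Finset.card_pos.mpr ⟨f₀, by simp⟩).ne'

theorem eq_of_symmetric_of_trace {m : ℕ} {S T : MTensor m}
    (hS : ∀ (σ : Equiv.Perm (Fin m)) x y, S (x ∘ σ) (y ∘ σ) = S x y)
    (hT : ∀ (σ : Equiv.Perm (Fin m)) x y, T (x ∘ σ) (y ∘ σ) = T x y)
    (h : ∀ A : M2, (S * elemTensor fun _ => A).trace = (T * elemTensor fun _ => A).trace) :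
    S = T := by
  let g : (Fin m → Fin 2 × Fin 2) → ℂ := fun f =>
    S (fun i => (f i).1) (fun i => (f i).2) - T (fun i => (f i).1) (fun i => (f i).2)
  have hg : g = 0 := by
    refine eq_zero_of_symmetric (fun σ f => ?_) fun a => ?_
    · exact congrArg₂ (· - ·) (hS σ (fun i => (f i).1) fun i => (f i).2)
        (hT σ (fun i => (f i).1) fun i => (f i).2)
    -- The transpose is needed because the trace pairs `S x y` with the entries `A (y i) (x i)`.
    · have := sub_eq_zero.mpr (h (Matrix.of fun i j => a (j, i)))
      rw [trace_mul_elemTensor, trace_mul_elemTensor, ← Finset.sum_sub_distrib] at this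
      simp only [← Finset.sum_sub_distrib, ← sub_mul, Matrix.of_apply] at this
      rw [← this, ← Fintype.sum_prod_type']
      exact Fintype.sum_equiv
        (Equiv.arrowProdEquivProdArrow (Fin m) (fun _ => Fin 2) (fun _ => Fin 2)) _ _ fun f => rfl
  ext x y
  exact sub_eq_zero.mp (congrFun hg fun i => (x i, y i))

end Polarization

/-! ### Counting matchings -/

section MatchingCount

variable {α : Type*}

open Classical in
/-- The collections of `r` pairwise disjoint two-element subsets of `A`. -/
def matchingsOn (A : Finset α) (r : ℕ) : Finset (Finset (Finset α)) :=
  ((A.powersetCard 2).powersetCard r).filter fun p => (p : Set (Finset α)).PairwiseDisjoint id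

theorem mem_matchingsOn {A : Finset α} {r : ℕ} {p : Finset (Finset α)} :
    p ∈ matchingsOn A r ↔ (∀ e ∈ p, e ⊆ A ∧ e.card = 2) ∧ p.card = r ∧
      (p : Set (Finset α)).PairwiseDisjoint id := by
  simp only [matchingsOn, Finset.mem_filter, Finset.mem_powersetCard, Finset.subset_iff (s₁ := p),
    and_assoc]

variable [DecidableEq α]

/-- Double counting of matchings with a marked pair: removing the mark `e` leaves an `r`-matching of
`A \ e`. -/
theorem succ_mul_card_matchingsOn (A : Finset α) (r : ℕ) :
    (r + 1) * (matchingsOn A (r + 1)).card =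
      ∑ e ∈ A.powersetCard 2, (matchingsOn (A \ e) r).card := by
  have h1 : (r + 1) * (matchingsOn A (r + 1)).card =
      ∑ p ∈ matchingsOn A (r + 1), p.card := by
    rw [Finset.sum_congr rfl fun p hp => (mem_matchingsOn.mp hp).2.1, Finset.sum_const,
      smul_eq_mul, mul_comm]
  rw [h1, ← Finset.card_sigma, ← Finset.card_sigma]
  refine Finset.card_nbij' (fun q => ⟨q.2, q.1.erase q.2⟩) (fun q => ⟨insert q.1 q.2, q.1⟩) ?_ ?_ ?_ ?_
  · rintro ⟨p, e⟩ h
    simp only [Finset.coe_sigma, Set.mem_sigma_iff, Finset.mem_coe, mem_matchingsOn,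
      Finset.mem_powersetCard] at h ⊢
    obtain ⟨⟨hp, hc, hd⟩, he⟩ := h
    refine ⟨hp e he, fun f hf => ?_, ?_, hd.subset (by simp)⟩
    · have hf' := Finset.mem_erase.mp hf
      exact ⟨Finset.subset_sdiff.mpr ⟨(hp f hf'.2).1, hd hf'.2 he hf'.1⟩, (hp f hf'.2).2⟩
    · rw [Finset.card_erase_of_mem he, hc]; rfl
  · rintro ⟨e, p⟩ h
    simp only [Finset.coe_sigma, Set.mem_sigma_iff, Finset.mem_coe, mem_matchingsOn,
      Finset.mem_powersetCard] at h ⊢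
    obtain ⟨he, hp, hc, hd⟩ := h
    have hdis : ∀ f ∈ p, Disjoint f e := fun f hf => (Finset.subset_sdiff.mp (hp f hf).1).2
    have hne : e ∉ p := fun hep => by
      have := hdis e hep
      rw [disjoint_self, Finset.bot_eq_empty] at this
      simp [this] at he
    refine ⟨⟨fun f hf => ?_, ?_, ?_⟩, Finset.mem_insert_self _ _⟩
    · rcases Finset.mem_insert.mp hf with rfl | hf
      · exact he
      · exact ⟨(hp f hf).1.trans Finset.sdiff_subset, (hp f hf).2⟩
    · rw [Finset.card_insert_of_notMem hne, hc]
    · rw [Finset.coe_insert]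
      exact hd.insert fun f hf _ => (hdis f hf).symm
  · rintro ⟨p, e⟩ h
    simp only [Finset.coe_sigma, Set.mem_sigma_iff, Finset.mem_coe] at h
    simp [Finset.insert_erase h.2]
  · rintro ⟨e, p⟩ h
    simp only [Finset.coe_sigma, Set.mem_sigma_iff, Finset.mem_coe, mem_matchingsOn,
      Finset.mem_powersetCard] at h
    obtain ⟨he, hp, hc, hd⟩ := h
    have hne : e ∉ p := fun hep => by
      have := (Finset.subset_sdiff.mp (hp e hep).1).2
      rw [disjoint_self, Finset.bot_eq_empty] at this
      simp [this] at he
    simp [Finset.erase_insert hne]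

theorem card_matchingsOn (r : ℕ) (A : Finset α) (h : 2 * r ≤ A.card) :
    (matchingsOn A r).card * (2 ^ r * r.factorial * (A.card - 2 * r).factorial) =
      A.card.factorial := by
  induction r generalizing A with
  | zero =>
    have : matchingsOn A 0 = {∅} := by
      ext p
      rw [mem_matchingsOn, Finset.mem_singleton, Finset.card_eq_zero]
      constructor
      · exact fun h => h.2.1
      · rintro rfl
        simp
    simp [this]
  | succ r ih =>
    obtain ⟨a, ha⟩ : ∃ a, A.card = a + 2 := ⟨A.card - 2, by omega⟩
    have hs := succ_mul_card_matchingsOn A r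
    have hterm : ∀ e ∈ A.powersetCard 2,
        (matchingsOn (A \ e) r).card * (2 ^ r * r.factorial * (a - 2 * r).factorial) =
          a.factorial := by
      intro e he
      have he' := Finset.mem_powersetCard.mp he
      have hc : (A \ e).card = a := by rw [Finset.card_sdiff_of_subset he'.1]; omega
      have := ih (A \ e) (by omega)
      rwa [hc] at this
    have hsum := congrArg (· * (2 ^ r * r.factorial * (a - 2 * r).factorial)) hs
    simp only [Finset.sum_mul] at hsum
    rw [Finset.sum_congr rfl hterm, Finset.sum_const, Finset.card_powersetCard, smul_eq_mul, ha]
      at hsum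
    have hch : (a + 2).choose 2 * 2 = (a + 2) * (a + 1) := by
      rw [Nat.choose_two_right]
      exact Nat.div_mul_cancel (Nat.even_mul_pred_self (a + 2)).two_dvd
    rw [ha, show a + 2 - 2 * (r + 1) = a - 2 * r by omega, Nat.factorial_succ r, pow_succ,
      Nat.factorial_succ (a + 1), Nat.factorial_succ a]
    linear_combination 2 * hsum + a.factorial * hch

end MatchingCount

/-! ### Matching operators and the depolarized symmetric projection -/

section MatchingOperators

variable {m : ℕ}

theorem heis_mul_elemTensor (e : Finset (Fin m)) (B : Fin m → M2) :
    heis e * elemTensor B =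
      ∑ U, elemTensor fun i => if i ∈ e then spin U * B i else B i := by
  rw [heis, Finset.sum_mul]
  refine Finset.sum_congr rfl fun U _ => ?_
  rw [elemTensor_mul]
  congr 1
  funext i
  split_ifs <;> simp

theorem trace_noncommProd_heis_mul (p : Finset (Finset (Fin m)))
    (hd : (p : Set (Finset (Fin m))).PairwiseDisjoint id) (comm) (B : Fin m → M2) :
    (p.noncommProd heis comm * elemTensor B).trace =
      (∏ e ∈ p, ∑ U, ∏ i ∈ e, (spin U * B i).trace) *
        ∏ i ∈ Finset.univ \ p.biUnion id, (B i).trace := by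
  induction p using Finset.induction_on generalizing B with
  | empty => simp [trace_elemTensor]
  | insert e p he ih =>
    have hdp : (p : Set (Finset (Fin m))).PairwiseDisjoint id := hd.subset (by simp)
    have hdis : ∀ f ∈ p, Disjoint f e := fun f hf =>
      hd (by simp [hf]) (by simp) fun h => he (h ▸ hf)
    have hdis' : Disjoint e (p.biUnion id) := by
      rw [Finset.disjoint_biUnion_right]
      exact fun f hf => (hdis f hf).symm
    -- The new pair is placed rightmost, so it is absorbed into the elementary tensor; the remaining
    -- pairs, disjoint from it, do not see the changed factors.
    rw [Finset.noncommProd_insert_of_notMem' _ _ _ _ he, mul_assoc, heis_mul_elemTensor,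
      Finset.mul_sum, Matrix.trace_sum]
    have hU : ∀ U, (p.noncommProd heis (comm.mono (by simp)) *
        elemTensor fun i => if i ∈ e then spin U * B i else B i).trace =
        (∏ i ∈ e, (spin U * B i).trace) * ((∏ e ∈ p, ∑ U, ∏ i ∈ e, (spin U * B i).trace) *
          ∏ i ∈ Finset.univ \ (insert e p).biUnion id, (B i).trace) := by
      intro U
      rw [ih hdp]
      have h1 : ∀ f ∈ p, ∑ W, ∏ i ∈ f,
          (spin W * if i ∈ e then spin U * B i else B i).trace =
          ∑ W, ∏ i ∈ f, (spin W * B i).trace := fun f hf =>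
        Finset.sum_congr rfl fun W _ => Finset.prod_congr rfl fun i hi => by
          rw [if_neg (Finset.disjoint_left.mp (hdis f hf) hi)]
      have h2 : Finset.univ \ p.biUnion id = e ∪ (Finset.univ \ (insert e p).biUnion id) := by
        ext i
        have := fun h : i ∈ e => Finset.disjoint_left.mp hdis' h
        simp only [Finset.biUnion_insert, Finset.mem_sdiff, Finset.mem_univ, true_and,
          Finset.mem_union, id]
        tauto
      have h3 : Disjoint e (Finset.univ \ (insert e p).biUnion id) := by
        rw [Finset.biUnion_insert]
        exact Finset.disjoint_left.mpr fun i hi h => by simp [hi] at h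
      rw [Finset.prod_congr rfl h1, h2, Finset.prod_union h3]
      have h4 : ∏ i ∈ e, (if i ∈ e then spin U * B i else B i).trace =
          ∏ i ∈ e, (spin U * B i).trace :=
        Finset.prod_congr rfl fun i hi => by rw [if_pos hi]
      have h5 : ∏ i ∈ Finset.univ \ (insert e p).biUnion id,
          (if i ∈ e then spin U * B i else B i).trace =
          ∏ i ∈ Finset.univ \ (insert e p).biUnion id, (B i).trace :=
        Finset.prod_congr rfl fun i hi => by
          rw [if_neg fun h => Finset.disjoint_left.mp h3 h hi]
      rw [h4, h5]
      ring
    rw [Finset.sum_congr rfl fun U _ => hU U, ← Finset.sum_mul, Finset.prod_insert he, mul_assoc]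

theorem trace_matchingTerm_mul {r : ℕ} (p : {p : Finset (Finset (Fin m)) // IsMatching m r p})
    (A : M2) : (matchingTerm p * elemTensor fun _ => A).trace =
      (∑ U, (spin U * A).trace ^ 2) ^ r * A.trace ^ (m - 2 * r) := by
  obtain ⟨p, hp⟩ := p
  obtain ⟨hr, h2, hd⟩ := id hp
  refine (trace_noncommProd_heis_mul p hd _ _).trans ?_
  have h1 : ∀ e ∈ p, ∑ U, ∏ _i ∈ e, (spin U * A).trace = ∑ U, (spin U * A).trace ^ 2 :=
    fun e he => Finset.sum_congr rfl fun U _ => by rw [Finset.prod_const, h2 e he]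
  have hc : (p.biUnion id).card = 2 * r := by
    rw [Finset.card_biUnion hd]
    simp only [id]
    rw [Finset.sum_congr rfl h2, Finset.sum_const, hr, smul_eq_mul, mul_comm]
  rw [Finset.prod_congr rfl h1, Finset.prod_const, Finset.prod_const, hr,
    Finset.card_sdiff_of_subset (Finset.subset_univ _), Finset.card_univ, Fintype.card_fin, hc]

theorem card_isMatching (m r : ℕ) :
    Nat.card {p : Finset (Finset (Fin m)) // IsMatching m r p} =
      (matchingsOn (Finset.univ : Finset (Fin m)) r).card := by
  classical
  rw [Nat.card_eq_fintype_card, Fintype.card_subtype]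
  congr 1
  ext p
  rw [mem_matchingsOn, Finset.mem_filter]
  simp only [IsMatching, Finset.mem_univ, Finset.subset_univ, true_and]
  tauto

/-- There are `m! / (2^r r! (m-2r)!)` matchings, and `(2r+1)!! · 2^r r! = (2r+1) · (2r)!`. This is
where the weights in `Vrho` meet those of `sum_pow_add_mul_pow_sub`. -/
theorem card_isMatching_div_doubleFactorial {r : ℕ} (h : 2 * r ≤ m) :
    (Nat.card {p : Finset (Finset (Fin m)) // IsMatching m r p} : ℝ) /
      (Nat.doubleFactorial (2 * r + 1) : ℝ) = (m.choose (2 * r) : ℝ) / (2 * r + 1) := by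
  have hN := card_matchingsOn r (Finset.univ : Finset (Fin m)) (by simpa using h)
  rw [← card_isMatching, Finset.card_univ, Fintype.card_fin] at hN
  have hc := Nat.choose_mul_factorial_mul_factorial h
  have hdf : (2 * r + 1).doubleFactorial * (2 ^ r * r.factorial) =
      (2 * r + 1) * (2 * r).factorial := by
    rw [← Nat.doubleFactorial_two_mul, ← Nat.factorial_succ,
      Nat.factorial_eq_mul_doubleFactorial]
  have hf : 0 < (m - 2 * r).factorial := Nat.factorial_pos _
  have hp : 0 < 2 ^ r * r.factorial := by positivity
  have hd : 0 < (2 * r + 1).doubleFactorial := Nat.doubleFactorial_pos _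
  rw [div_eq_div_iff (by positivity) (by positivity)]
  norm_cast
  refine Nat.eq_of_mul_eq_mul_right (Nat.mul_pos hp hf) ?_
  calc _ = (2 * r + 1) * (Nat.card {p : Finset (Finset (Fin m)) // IsMatching m r p} *
        (2 ^ r * r.factorial * (m - 2 * r).factorial)) := by ring
    _ = (m.choose (2 * r) * (m - 2 * r).factorial) *
        ((2 * r + 1) * (2 * r).factorial) := by rw [hN, ← hc]; ring
    _ = _ := by rw [← hdf]; ring

theorem trace_Vrho_mul (m : ℕ) (α : ℂ) (A : M2) :
    (Vrho m α * elemTensor fun _ => A).trace =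
      ∑ r ∈ Finset.range (m / 2 + 1), (m.choose (2 * r) : ℂ) / (2 * r + 1) * α ^ (2 * r) *
        ((∑ U, (spin U * A).trace ^ 2) ^ r * A.trace ^ (m - 2 * r)) := by
  classical
  rw [Vrho, Finset.sum_mul, Matrix.trace_sum]
  refine Finset.sum_congr rfl fun r hr => ?_
  have h : 2 * r ≤ m := by have := Finset.mem_range.mp hr; omega
  have hc := congrArg ((↑) : ℝ → ℂ) (card_isMatching_div_doubleFactorial h)
  push_cast at hc
  rw [Matrix.smul_mul, Matrix.trace_smul, matchingOp, Finset.sum_mul, Matrix.trace_sum,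
    Finset.sum_congr rfl fun p _ => trace_matchingTerm_mul p A, Finset.sum_const, Finset.card_univ,
    ← Nat.card_eq_fintype_card, nsmul_eq_mul, smul_eq_mul, ← hc]
  ring

/-- Relabelling of the tensor factors. -/
def permTensor (σ : Equiv.Perm (Fin m)) : MTensor m ≃ₐ[ℂ] MTensor m :=
  Matrix.reindexAlgEquiv ℂ ℂ (Equiv.arrowCongr σ (Equiv.refl (Fin 2)))

theorem permTensor_apply (σ : Equiv.Perm (Fin m)) (X : MTensor m) (x y : Fin m → Fin 2) :
    permTensor σ X x y = X (x ∘ σ) (y ∘ σ) := rfl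

theorem permTensor_elemTensor (σ : Equiv.Perm (Fin m)) (A : Fin m → M2) :
    permTensor σ (elemTensor A) = elemTensor fun i => A (σ.symm i) := by
  ext x y
  rw [permTensor_apply]
  simp only [elemTensor, Matrix.of_apply, Function.comp_apply]
  exact Fintype.prod_equiv σ _ _ fun i => by simp

theorem permTensor_heis (σ : Equiv.Perm (Fin m)) (e : Finset (Fin m)) :
    permTensor σ (heis e) = heis (e.map σ.toEmbedding) := by
  simp only [heis, map_sum, permTensor_elemTensor, Finset.mem_map_equiv]

theorem IsMatching.map {r : ℕ} {p : Finset (Finset (Fin m))} (hp : IsMatching m r p)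
    (σ : Equiv.Perm (Fin m)) :
    IsMatching m r (p.map (Finset.mapEmbedding σ.toEmbedding).toEmbedding) := by
  obtain ⟨hr, h2, hd⟩ := hp
  refine ⟨by rw [Finset.card_map, hr], fun e he => ?_, fun e he f hf hne => ?_⟩
  · obtain ⟨e', he', rfl⟩ := Finset.mem_map.mp he
    exact (Finset.card_map _).trans (h2 e' he')
  · obtain ⟨e', he', rfl⟩ := Finset.mem_map.mp he
    obtain ⟨f', hf', rfl⟩ := Finset.mem_map.mp hf
    exact (Finset.disjoint_map _).mpr (hd he' hf' fun h => hne (h ▸ rfl))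

theorem permTensor_matchingTerm (σ : Equiv.Perm (Fin m)) {r : ℕ}
    (p : {p : Finset (Finset (Fin m)) // IsMatching m r p}) :
    permTensor σ (matchingTerm p) = matchingTerm ⟨_, p.2.map σ⟩ := by
  refine (Finset.map_noncommProd p.1 heis _ (permTensor σ)).trans ?_
  simp only [matchingTerm, permTensor_heis, Finset.noncommProd, Finset.map_val, Multiset.map_map]
  rfl

theorem permTensor_matchingOp (σ : Equiv.Perm (Fin m)) (r : ℕ) :
    permTensor σ (matchingOp m r) = matchingOp m r := by
  classical
  rw [matchingOp, map_sum]
  refine Fintype.sum_bijective (fun p => ⟨_, p.2.map σ⟩) ?_ _ _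
    fun p => permTensor_matchingTerm σ p
  refine Finite.injective_iff_bijective.mp fun p q h => Subtype.ext ?_
  exact Finset.map_injective _ (congrArg Subtype.val h)

theorem permTensor_Vrho (σ : Equiv.Perm (Fin m)) (α : ℂ) :
    permTensor σ (Vrho m α) = Vrho m α := by
  simp only [Vrho, map_sum, map_smul, permTensor_matchingOp]

theorem permTensor_mapTensor (σ : Equiv.Perm (Fin m)) (T : M2 →ₗ[ℂ] M2) (X : MTensor m) :
    permTensor σ (mapTensor m T X) = mapTensor m T (permTensor σ X) := by
  have : (permTensor σ).toLinearMap ∘ₗ mapTensor m T = mapTensor m T ∘ₗ (permTensor σ).toLinearMap :=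
    linearMap_ext_elemTensor fun A => by simp [mapTensor_elemTensor, permTensor_elemTensor]
  exact LinearMap.congr_fun this X

theorem permTensor_symProj (σ : Equiv.Perm (Fin m)) : permTensor σ (symProj m) = symProj m := by
  ext x y
  simp [permTensor_apply, symProj, upCount_comp_perm]

/-- The depolarized symmetric projection is a multiple of `V_ρ`. -/
theorem mapTensor_depol_symProj (m : ℕ) (τ : ℂ) :
    mapTensor m (depol τ) (symProj m) = (((m : ℂ) + 1) / 2 ^ m) • Vrho m (2 * τ) := by
  refine eq_of_symmetric_of_trace (fun σ x y => ?_) (fun σ x y => ?_) fun A => ?_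
  · have h := permTensor_mapTensor σ (depol τ) (symProj m)
    rw [permTensor_symProj] at h
    exact congrFun (congrFun h x) y
  · have h := map_smul (permTensor σ) (((m : ℂ) + 1) / 2 ^ m) (Vrho m (2 * τ))
    rw [permTensor_Vrho] at h
    exact congrFun (congrFun h x) y
  · set q : ℂ := ∑ U, (spin U * A).trace ^ 2 with hq
    -- In Pauli coordinates `det A = (Tr A / 2)² - q`, so `A` has eigenvalues `Tr A / 2 ± s` and its
    -- depolarization `Tr A / 2 ± τ s`.
    obtain ⟨s, hs⟩ : ∃ s : ℂ, s ^ 2 = q := IsAlgClosed.exists_pow_nat_eq q two_pos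
    have hdet : A.det = (A.trace / 2) ^ 2 - s ^ 2 := by
      rw [hs, hq, Matrix.eta_fin_two A]
      simp [Fin.sum_univ_three, spin, pauli, Matrix.trace_fin_two, Matrix.det_fin_two]
      ring_nf
      simp
      ring
    rw [trace_mapTensor_mul (trace_depol_mul τ), mapTensor_elemTensor, trace_symProj_mul,
      symTrace_eq_sum m (depol τ A) (α := A.trace / 2 + τ * s) (β := A.trace / 2 - τ * s)
        (by rw [trace_depol]; ring) (by rw [det_depol, hdet]; ring),
      sum_pow_add_mul_pow_sub, Matrix.smul_mul, Matrix.trace_smul, trace_Vrho_mul, smul_eq_mul,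
      ← hq, ← hs, div_mul_eq_mul_div, mul_div_assoc, Finset.sum_div]
    congr 1
    refine Finset.sum_congr rfl fun r hr => ?_
    have hm : m = 2 * r + (m - 2 * r) := by have := Finset.mem_range.mp hr; omega
    have h2 : (2 : ℂ) ^ m = 2 ^ (2 * r) * 2 ^ (m - 2 * r) := by rw [← pow_add, ← hm]
    rw [h2, div_pow, ← pow_mul, mul_pow 2 τ, mul_pow τ s]
    field_simp

end MatchingOperators

/-- Every denominator is at least `3` once `r = 0` is dropped; the even binomial terms are then part
of `(1+s)^m - 1`. Used both for the eigenvalue bound and for the norm bound. -/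
theorem sum_choose_even_div_le (m : ℕ) {s : ℝ} (hs : 0 ≤ s) :
    ∑ r ∈ Finset.range (m / 2), (m.choose (2 * (r + 1)) : ℝ) / (2 * ((r + 1 : ℕ) : ℝ) + 1) *
      s ^ (2 * (r + 1)) ≤ ((1 + s) ^ m - 1) / 3 := by
  have h1 : ∀ r ∈ Finset.range (m / 2), (m.choose (2 * (r + 1)) : ℝ) / (2 * ((r + 1 : ℕ) : ℝ) + 1) *
      s ^ (2 * (r + 1)) ≤ (m.choose (2 * (r + 1)) : ℝ) * s ^ (2 * (r + 1)) / 3 := by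
    intro r _
    rw [div_mul_eq_mul_div]
    refine div_le_div_of_nonneg_left (by positivity) (by norm_num) ?_
    push_cast
    linarith [Nat.cast_nonneg (α := ℝ) r]
  refine (Finset.sum_le_sum h1).trans ?_
  rw [← Finset.sum_div]
  refine div_le_div_of_nonneg_right ?_ (by norm_num)
  rw [le_sub_iff_add_le, add_comm 1 s, add_pow]
  have hinj : Set.InjOn (fun r => 2 * (r + 1)) (Finset.range (m / 2) : Set ℕ) := by
    intro a _ b _ h
    simp only at h
    omega
  rw [← Finset.sum_image (f := fun j => (m.choose j : ℝ) * s ^ j) hinj]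
  have hsub : (Finset.range (m / 2)).image (fun r => 2 * (r + 1)) ⊆
      (Finset.range (m + 1)).erase 0 := by
    intro j hj
    obtain ⟨r, hr, rfl⟩ := Finset.mem_image.mp hj
    rw [Finset.mem_range] at hr
    rw [Finset.mem_erase, Finset.mem_range]
    omega
  rw [← Finset.sum_erase_add _ _ (Finset.mem_range.mpr (Nat.succ_pos m))]
  refine add_le_add ?_ (by simp)
  refine (Finset.sum_le_sum_of_subset_of_nonneg hsub fun _ _ _ => by positivity).trans
    (le_of_eq ?_)
  exact Finset.sum_congr rfl fun j _ => by rw [one_pow, mul_one, mul_comm]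

/-! ### Operator-norm distance of `V_ρ` from the identity -/

section OperatorNorm

open scoped Matrix.Norms.L2Operator

variable {m : ℕ}

theorem norm_elemTensor_of_mul_self (A : Fin m → M2) (hA : ∀ i, (A i)ᴴ * A i = 1) :
    ‖elemTensor A‖ = 1 := by
  have h : ‖elemTensor A‖ * ‖elemTensor A‖ = 1 := by
    rw [← Matrix.l2_opNorm_conjTranspose_mul_self, conjTranspose_elemTensor, elemTensor_mul]
    simp only [hA, elemTensor_one]
    exact CStarRing.norm_one
  nlinarith [norm_nonneg (elemTensor A)]

theorem norm_heis_le {e : Finset (Fin m)} (he : e.card = 2) : ‖heis e‖ ≤ 3 / 4 := by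
  have h : ∀ U, ‖(elemTensor fun i => if i ∈ e then spin U else 1 : MTensor m)‖ = 1 / 4 := by
    intro U
    have h1 : (fun i => if i ∈ e then spin U else 1 : Fin m → M2) =
        fun i => (if i ∈ e then (1 / 2 : ℂ) else 1) • if i ∈ e then pauli U else 1 := by
      funext i
      split_ifs <;> simp [spin]
    rw [h1, elemTensor_smul, norm_smul, norm_elemTensor_of_mul_self, Finset.prod_ite_mem,
      Finset.univ_inter, Finset.prod_const, he]
    · norm_num
    · intro i
      split_ifs <;> simp [pauli_isHermitian, pauli_mul_self]
  rw [heis]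
  refine (norm_sum_le _ _).trans ?_
  rw [Finset.sum_congr rfl fun U _ => h U]
  norm_num

theorem norm_noncommProd_le {ι R : Type*} [NormedRing R] [NormOneClass R] [DecidableEq ι]
    (s : Finset ι) (f : ι → R) (comm) {c : ℝ} (hc : 0 ≤ c) (hf : ∀ i ∈ s, ‖f i‖ ≤ c) :
    ‖s.noncommProd f comm‖ ≤ c ^ s.card := by
  induction s using Finset.induction_on with
  | empty => simp
  | insert a s ha ih =>
    rw [Finset.noncommProd_insert_of_notMem _ _ _ _ ha, Finset.card_insert_of_notMem ha, pow_succ']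
    exact (norm_mul_le _ _).trans (mul_le_mul (hf a (Finset.mem_insert_self _ _))
      (ih _ fun i hi => hf i (Finset.mem_insert_of_mem hi)) (norm_nonneg _) hc)

theorem norm_matchingOp_le (m r : ℕ) : ‖matchingOp m r‖ ≤
    (Nat.card {p : Finset (Finset (Fin m)) // IsMatching m r p} : ℝ) * (3 / 4) ^ r := by
  classical
  have : NormOneClass (MTensor m) := ⟨CStarRing.norm_one⟩
  have h : ∀ p : {p : Finset (Finset (Fin m)) // IsMatching m r p},
      ‖matchingTerm p‖ ≤ (3 / 4) ^ r := by
    rintro ⟨p, hp⟩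
    have := norm_noncommProd_le p heis
      (fun _ he _ hf hne => heis_commute (hp.2.2 he hf hne)) (c := 3 / 4) (by norm_num)
      fun e he => norm_heis_le (hp.2.1 e he)
    exact this.trans_eq (congrArg _ hp.1)
  rw [matchingOp]
  refine (norm_sum_le _ _).trans ((Finset.sum_le_sum fun p _ => h p).trans (le_of_eq ?_))
  rw [Finset.sum_const, Finset.card_univ, ← Nat.card_eq_fintype_card, nsmul_eq_mul]

theorem matchingOp_zero (m : ℕ) : matchingOp m 0 = 1 := by
  classical
  have h0 : IsMatching m 0 ∅ := ⟨by simp, by simp, by simp⟩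
  have hu : ∀ p : {p : Finset (Finset (Fin m)) // IsMatching m 0 p}, p = ⟨∅, h0⟩ :=
    fun p => Subtype.ext (Finset.card_eq_zero.mp p.2.1)
  rw [matchingOp, Fintype.sum_eq_single ⟨∅, h0⟩ fun p hp => absurd (hu p) hp]
  exact Finset.noncommProd_empty _ _

/-- The term `r = 0` is the identity. In the others `(3/4)^r |α|^{2r} = (√3 |α| / 2)^{2r}`, which
explains the `√3`. -/
theorem norm_Vrho_sub_one_le (m : ℕ) (α : ℂ) :
    ‖Vrho m α - 1‖ ≤ ((1 + Real.sqrt 3 * (‖α‖ / 2)) ^ m - 1) / 3 := by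
  refine le_trans ?_ (sum_choose_even_div_le m (by positivity))
  rw [Vrho, Finset.sum_range_succ']
  simp only [matchingOp_zero, mul_zero, pow_zero, Nat.doubleFactorial, Nat.cast_one,
    div_one, one_smul, add_sub_cancel_right]
  refine (norm_sum_le _ _).trans (Finset.sum_le_sum fun r hr => ?_)
  have hr' : 2 * (r + 1) ≤ m := by have := Finset.mem_range.mp hr; omega
  rw [norm_smul, norm_div, norm_pow, Complex.norm_natCast]
  refine (mul_le_mul_of_nonneg_left (norm_matchingOp_le m (r + 1)) (by positivity)).trans
    (le_of_eq ?_)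
  rw [← card_isMatching_div_doubleFactorial hr', mul_pow, pow_mul (Real.sqrt 3),
    Real.sq_sqrt (by norm_num), div_pow, div_pow, pow_mul 2 2 (r + 1),
    show ((2 : ℝ) ^ 2) = 4 by norm_num]
  ring

/-- An eigenvector for `x` is one of `V - 1` for `x / c - 1`, whose modulus the operator norm
bounds. -/
theorem le_of_hasEigenvalue_smul {ι : Type*} [Fintype ι] [DecidableEq ι] {c x : ℝ} (hc : 0 < c)
    {V : Matrix ι ι ℂ} (h : Module.End.HasEigenvalue (Matrix.toLin' ((c : ℂ) • V)) (x : ℂ)) :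
    c * (1 - ‖V - 1‖) ≤ x := by
  obtain ⟨v, hv⟩ := h.exists_hasEigenvector
  have hv0 : v ≠ 0 := hv.2
  have hcx : (c : ℂ) • (V *ᵥ v) = (x : ℂ) • v := by
    simpa [Matrix.smul_mulVec] using hv.apply_eq_smul
  have hc' : (c : ℂ) ≠ 0 := by exact_mod_cast hc.ne'
  have hV : (V - 1) *ᵥ v = ((x / c - 1 : ℝ) : ℂ) • v := by
    rw [Matrix.sub_mulVec, Matrix.one_mulVec, ← inv_smul_smul₀ hc' (V *ᵥ v), hcx, smul_smul]
    push_cast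
    rw [sub_smul, one_smul, div_eq_inv_mul]
  have hle : ‖WithLp.toLp 2 ((V - 1) *ᵥ v)‖ ≤ ‖V - 1‖ * ‖WithLp.toLp 2 v‖ :=
    Matrix.l2_opNorm_mulVec (V - 1) (WithLp.toLp 2 v)
  have hpos : 0 < ‖WithLp.toLp 2 v‖ := by
    rw [norm_pos_iff]
    exact fun h => hv0 (by simpa using h)
  rw [hV, WithLp.toLp_smul, norm_smul] at hle
  have hle' := le_of_mul_le_mul_right hle hpos
  rw [Complex.norm_real] at hle'
  have := (abs_le.mp hle').1
  have hx : 1 - ‖V - 1‖ ≤ x / c := by linarith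
  rwa [le_div_iff₀ hc, mul_comm] at hx

theorem le_of_hasEigenvalue_smul_Vrho {c x : ℝ} (hc : 0 < c) {α : ℂ}
    (h : Module.End.HasEigenvalue (Matrix.toLin' ((c : ℂ) • Vrho m α)) (x : ℂ)) :
    c / 3 * (4 - (1 + Real.sqrt 3 * (‖α‖ / 2)) ^ m) ≤ x := by
  refine le_trans ?_ (le_of_hasEigenvalue_smul hc h)
  have := mul_le_mul_of_nonneg_left (norm_Vrho_sub_one_le m α) hc.le
  linarith

end OperatorNorm

/-! ### The leg tensors and the image of the identity -/

section LegTensors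

/-- The closed form of `V_k^{m+1}`: the symmetric vector of `m + 1` spins as a `2 × 2^m` matrix. -/
def legV (m k : ℕ) : Matrix (Fin 2) (Fin m → Fin 2) ℂ := Matrix.of fun b y =>
  if upCount y + (1 - (b : ℕ)) = k then ((1 / Real.sqrt ((m + 1).choose k : ℝ) : ℝ) : ℂ) else 0

/-- Splitting one spin off the symmetric vector of `m + 1` spins: the square-root coefficients are
exactly those that turn the normalization for `m` spins into that for `m + 1`. -/
theorem Vtensor_succ (m k : ℕ) : Vtensor (m + 1) k = legV m k := by
  ext b y
  change ((Real.sqrt ((((m + 1 : ℕ) : ℝ) - k) / (m + 1 : ℕ)) : ℝ) : ℂ) *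
      (ketDown b * star (symVec m k y)) +
    ((Real.sqrt ((k : ℝ) / (m + 1 : ℕ)) : ℝ) : ℂ) * (ketUp b * star (symVec m (k - 1) y)) =
    if upCount y + (1 - (b : ℕ)) = k then
      ((1 / Real.sqrt ((m + 1).choose k : ℝ) : ℝ) : ℂ) else 0
  have hsym : ∀ j, star (symVec m j y) = symVec m j y := by
    intro j
    simp only [symVec]
    split_ifs <;> simp
  rw [hsym, hsym]
  change _ * (_ * if upCount y = k then _ else _) +
    _ * (_ * if upCount y = k - 1 then _ else _) = _
  have hm : (0 : ℝ) < m + 1 := by positivity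
  fin_cases b
  -- At `k = 0` truncated subtraction turns `k - 1` into `0`, but the coefficient is `√0`, so the
  -- term is absent as it should be.
  · rcases k with _ | j
    · simp [ketDown, ketUp]
    · by_cases h : upCount y = j
      · have hj : (0 : ℝ) < m.choose j := by
          exact_mod_cast Nat.choose_pos (h ▸ upCount_le y)
        have hj' : (0 : ℝ) < (m + 1).choose (j + 1) := by
          exact_mod_cast Nat.choose_pos (Nat.succ_le_succ (h ▸ upCount_le y))
        have hc : ((m : ℝ) + 1) * m.choose j = (m + 1).choose (j + 1) * (j + 1) := by
          exact_mod_cast Nat.add_one_mul_choose_eq m j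
        simp only [Fin.zero_eta, ketDown, ketUp, h, Matrix.cons_val_zero, zero_mul, mul_zero,
          zero_add, one_mul, Nat.add_sub_cancel, if_true, Nat.sub_zero]
        rw [← Complex.ofReal_mul, ← Real.sqrt_one, ← Real.sqrt_div zero_le_one,
          ← Real.sqrt_div zero_le_one, ← Real.sqrt_mul (by positivity)]
        congr 2
        push_cast
        field_simp
        linarith
      · simp [ketDown, ketUp, h]
  · by_cases h : upCount y = k
    · have hk : k ≤ m := h ▸ upCount_le y
      have hj : (0 : ℝ) < m.choose k := by exact_mod_cast Nat.choose_pos hk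
      have hj' : (0 : ℝ) < (m + 1).choose k := by
        exact_mod_cast Nat.choose_pos (hk.trans (Nat.le_succ m))
      have hc : (m.choose k : ℝ) * (m + 1) = (m + 1).choose k * ((m : ℝ) + 1 - k) := by
        have := congrArg (Nat.cast (R := ℝ)) (Nat.choose_mul_succ_eq m k)
        rw [Nat.cast_mul, Nat.cast_mul, Nat.cast_sub (hk.trans (Nat.le_succ m))] at this
        exact_mod_cast this
      have hk' : (0 : ℝ) ≤ m + 1 - k := by
        have : (k : ℝ) ≤ m := by exact_mod_cast hk
        linarith
      simp only [Fin.mk_one, ketDown, ketUp, h, Matrix.cons_val_one, Matrix.cons_val_zero, zero_mul,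
        mul_zero, add_zero, one_mul, if_true, Nat.sub_self]
      rw [← Complex.ofReal_mul, ← Real.sqrt_one, ← Real.sqrt_div zero_le_one,
        ← Real.sqrt_div zero_le_one, ← Real.sqrt_mul (by push_cast; positivity)]
      congr 2
      push_cast
      field_simp
      linarith
    · simp [ketDown, ketUp, h]

/-- `W_k^{m+1}` as a matrix with columns labelled by `m` spins. -/
def legW (m k : ℕ) : Matrix (Fin 2) (Fin m → Fin 2) ℂ := singletK * legV m k

theorem Wtensor_succ (m k : ℕ) : Wtensor (m + 1) k = legW m k := by
  rw [Wtensor, Vtensor_succ, legW]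

/-- The undecorated transfer operator with values in the matrices on `m` spins. -/
def legE (m : ℕ) : M2 →ₗ[ℂ] MTensor m := ELzero (m + 1)

theorem legE_apply (m : ℕ) (B : M2) :
    legE m B = ∑ k : Fin (m + 2), (legW m k)ᴴ * B * legW m k := by
  rw [← Finset.sum_range fun k => (legW m k)ᴴ * B * legW m k]
  change ∑ k ∈ Finset.range (m + 1 + 1), (Wtensor (m + 1) k)ᴴ * B * Wtensor (m + 1) k = _
  simp only [Wtensor_succ]

theorem EL_succ (m n : ℕ) (B : M2) :
    EL (m + 1) n B = mapTensor m (depol ((-1 / 3) ^ n)) (legE m B) := by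
  change ((mapTensor m transferE) ^ n) (legE m B) = _
  rw [mapTensor_pow, transferE_eq_depol, depol_pow]

theorem singletK_conjTranspose_mul : singletKᴴ * singletK = 1 := by
  have h : singletK = !![0, 1; -1, 0] := by
    ext i j
    rw [singletK, Matrix.sub_apply, Matrix.vecMulVec_apply, Matrix.vecMulVec_apply]
    fin_cases i <;> fin_cases j <;> simp [ketUp, ketDown]
  rw [h]
  ext i j
  fin_cases i <;> fin_cases j <;> simp [Matrix.mul_apply, Fin.sum_univ_two]

theorem singletK_mul_conjTranspose : singletK * singletKᴴ = 1 :=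
  mul_eq_one_comm.mp singletK_conjTranspose_mul

theorem legV_mul_star (m : ℕ) (a b : Fin 2) (x y : Fin m → Fin 2) :
    ∑ k : Fin (m + 2), legV m k a x * star (legV m k b y) =
      if upCount x + (1 - (a : ℕ)) = upCount y + (1 - (b : ℕ)) then
        1 / ((m + 1).choose (upCount y + (1 - (b : ℕ))) : ℂ) else 0 := by
  rw [← Finset.sum_range fun k => legV m k a x * star (legV m k b y)]
  have hmem : upCount y + (1 - (b : ℕ)) ∈ Finset.range (m + 2) := by
    have := upCount_le y
    rw [Finset.mem_range]; omega
  rw [Finset.sum_eq_single_of_mem _ hmem fun k _ hk => by simp [legV, hk.symm]]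
  simp only [legV, Matrix.of_apply, if_true]
  split_ifs
  · rw [Complex.star_def, Complex.conj_ofReal, ← Complex.ofReal_mul, ← sq, div_pow, one_pow,
      Real.sq_sqrt (Nat.cast_nonneg _)]
    push_cast
    rfl
  · rw [zero_mul]

theorem choose_div_choose_succ {m k : ℕ} (hk : k ≤ m) :
    (1 : ℂ) / (m + 1).choose k = ((m : ℂ) + 1 - k) / ((m + 1) * m.choose k) := by
  have h1 : ((m + 1).choose k : ℂ) ≠ 0 := by
    exact_mod_cast (Nat.choose_pos (hk.trans (Nat.le_succ m))).ne'
  have h2 : (m.choose k : ℂ) ≠ 0 := by exact_mod_cast (Nat.choose_pos hk).ne'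
  have h3 : ((m : ℂ) + 1) ≠ 0 := by exact_mod_cast Nat.succ_ne_zero m
  have := congrArg (Nat.cast (R := ℂ)) (Nat.choose_mul_succ_eq m k)
  rw [Nat.cast_mul, Nat.cast_mul, Nat.cast_sub (hk.trans (Nat.le_succ m))] at this
  push_cast at this
  rw [div_eq_div_iff h1 (mul_ne_zero h3 h2)]
  linear_combination this

theorem choose_div_choose_succ_succ {m k : ℕ} (hk : k ≤ m) :
    (1 : ℂ) / (m + 1).choose (k + 1) = ((k : ℂ) + 1) / ((m + 1) * m.choose k) := by
  have h1 : ((m + 1).choose (k + 1) : ℂ) ≠ 0 := by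
    exact_mod_cast (Nat.choose_pos (Nat.succ_le_succ hk)).ne'
  have h2 : (m.choose k : ℂ) ≠ 0 := by exact_mod_cast (Nat.choose_pos hk).ne'
  have h3 : ((m : ℂ) + 1) ≠ 0 := by exact_mod_cast Nat.succ_ne_zero m
  have := congrArg (Nat.cast (R := ℂ)) (Nat.add_one_mul_choose_eq m k)
  push_cast at this
  rw [div_eq_div_iff h1 (mul_ne_zero h3 h2)]
  linear_combination this

/-- Tracing one spin out of the symmetric projection on `m + 1` spins: the two orientations of that
spin carry weights `(m+1-k)/(m+1)` and `(k+1)/(m+1)`, whose sum does not depend on `k`. -/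
theorem legE_one (m : ℕ) : legE m 1 = (((m : ℂ) + 2) / (m + 1)) • symProj m := by
  have h : legE m 1 = ∑ k : Fin (m + 2), (legV m k)ᴴ * legV m k := by
    rw [legE_apply]
    refine Finset.sum_congr rfl fun k _ => ?_
    rw [Matrix.mul_one, legW, Matrix.conjTranspose_mul, Matrix.mul_assoc, ← Matrix.mul_assoc singletKᴴ,
      singletK_conjTranspose_mul, Matrix.one_mul]
  rw [h]
  ext x y
  simp only [Matrix.sum_apply, Matrix.mul_apply, Matrix.conjTranspose_apply]
  rw [Finset.sum_comm]
  simp only [mul_comm (star _), legV_mul_star, Fin.sum_univ_two, Fin.val_zero, Fin.val_one,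
    Nat.sub_self, Nat.sub_zero, add_zero, Nat.add_right_cancel_iff, Matrix.smul_apply, symProj,
    Matrix.of_apply, smul_eq_mul]
  have hx := upCount_le x
  have h3 : ((m : ℂ) + 1) ≠ 0 := by exact_mod_cast Nat.succ_ne_zero m
  have h2 : (m.choose (upCount x) : ℂ) ≠ 0 := by exact_mod_cast (Nat.choose_pos hx).ne'
  by_cases hxy : upCount x = upCount y
  · rw [if_pos hxy.symm, if_pos hxy.symm, if_pos hxy, choose_div_choose_succ hx,
      choose_div_choose_succ_succ hx, ← hxy]
    field_simp
    ring
  · rw [if_neg (Ne.symm hxy), if_neg (Ne.symm hxy), if_neg hxy]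
    simp

theorem QL_succ (m n : ℕ) :
    QL (m + 1) n = (((m : ℂ) + 2) / 2 ^ m) • Vrho m (alpha n) := by
  refine (EL_succ m n 1).trans ?_
  have h3 : ((m : ℂ) + 1) ≠ 0 := by exact_mod_cast Nat.succ_ne_zero m
  rw [legE_one, map_smul, mapTensor_depol_symProj, smul_smul, alpha]
  congr 1
  field_simp

end LegTensors

/-! ### The adjoint leg map on the depolarized projection -/

section Overlap

open Polynomial

theorem eq_of_sum_pow_eq {N : ℕ} {a b : ℕ → ℂ}
    (h : ∀ z : ℂ, ∑ k ∈ Finset.range N, a k * z ^ k = ∑ k ∈ Finset.range N, b k * z ^ k) {k : ℕ}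
    (hk : k < N) : a k = b k := by
  have hp : ∑ k ∈ Finset.range N, C (a k) * X ^ k = ∑ k ∈ Finset.range N, C (b k) * X ^ k := by
    refine Polynomial.funext fun z => ?_
    simpa [eval_finsetSum] using h z
  simpa [finsetSum_coeff, coeff_C_mul, coeff_X_pow, hk] using congrArg (fun p => coeff p k) hp

/-- The overlap of the depolarized symmetric projection with itself. -/
def overlap (m : ℕ) (t : ℝ) : ℝ :=
  ((m : ℝ) + 1) / 2 ^ m * ∑ r ∈ Finset.range (m / 2 + 1),
    (m.choose (2 * r) : ℝ) / (2 * r + 1) * t ^ (2 * r)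

/-- The matrix has rank one and trace `uz + 1`, so its depolarization has eigenvalues `(uz+1)(1 ±
t)/2`. -/
theorem symTrace_depol_rankOne (m : ℕ) (t : ℝ) (z u : ℂ) :
    symTrace m (depol t !![z * u, z; u, 1]) = (overlap m t : ℂ) * (u * z + 1) ^ m := by
  rw [symTrace_eq_sum m _ (α := (u * z + 1) / 2 + (t * ((u * z + 1) / 2)))
    (β := (u * z + 1) / 2 - (t * ((u * z + 1) / 2)))
    (by rw [trace_depol, Matrix.trace_fin_two]; simp; ring)
    (by rw [det_depol, Matrix.trace_fin_two, Matrix.det_fin_two]; simp; ring),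
    sum_pow_add_mul_pow_sub, overlap]
  push_cast
  rw [div_mul_eq_mul_div, div_mul_eq_mul_div, mul_assoc, mul_div_assoc, Finset.sum_mul,
    Finset.sum_div]
  congr 1
  refine Finset.sum_congr rfl fun r hr => ?_
  have hm : m = 2 * r + (m - 2 * r) := by have := Finset.mem_range.mp hr; omega
  have h2 : ∀ w : ℂ, w ^ m = w ^ (2 * r) * w ^ (m - 2 * r) := by
    intro w; rw [← pow_add, ← hm]
  rw [h2 2, h2 (u * z + 1), mul_pow, div_pow, div_pow]
  field_simp

/-- The depolarized projection compresses to a scalar on the symmetric subspace, as Schur's lemma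
predicts. Here this is read off from a generating function in two variables. -/
theorem sum_mapTensor_symProj_mul (m : ℕ) (t : ℝ) (G : ℕ → ℕ → ℂ) :
    ∑ x, ∑ y, mapTensor m (depol t) (symProj m) x y * G (upCount x) (upCount y) =
      (overlap m t : ℂ) * ∑ k ∈ Finset.range (m + 1), (m.choose k : ℂ) * G k k := by
  set S := mapTensor m (depol t) (symProj m) with hS
  let s : ℕ → ℕ → ℂ := fun k l =>
    ∑ x, ∑ y, if upCount x = k ∧ upCount y = l then S x y else 0
  have hsum : ∀ G : ℕ → ℕ → ℂ, ∑ x, ∑ y, S x y * G (upCount x) (upCount y) =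
      ∑ k ∈ Finset.range (m + 1), ∑ l ∈ Finset.range (m + 1), s k l * G k l := by
    intro G
    have h1 : ∀ x y, S x y * G (upCount x) (upCount y) =
        ∑ k ∈ Finset.range (m + 1), ∑ l ∈ Finset.range (m + 1),
          (if upCount x = k ∧ upCount y = l then S x y else 0) * G k l := by
      intro x y
      rw [Finset.sum_eq_single_of_mem (upCount x)
        (Finset.mem_range_succ_iff.mpr (upCount_le x)),
        Finset.sum_eq_single_of_mem (upCount y) (Finset.mem_range_succ_iff.mpr (upCount_le y))]
      · simp
      · intro l _ hl
        rw [if_neg fun h => hl h.2.symm, zero_mul]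
      · intro k _ hk
        exact Finset.sum_eq_zero fun l _ => by rw [if_neg fun h => hk h.1.symm, zero_mul]
    simp only [h1, s, Finset.sum_mul]
    rw [Finset.sum_congr rfl fun x _ => Finset.sum_comm, Finset.sum_comm]
    refine Finset.sum_congr rfl fun k _ => ?_
    rw [Finset.sum_congr rfl fun x _ => Finset.sum_comm, Finset.sum_comm]
  -- Pairing with the tensor power of a rank-one matrix generates all block sums `s k l`; the right
  -- side depends on `uz` alone, so off-diagonal blocks vanish.
  have hgen : ∀ u z : ℂ, ∑ k ∈ Finset.range (m + 1),
      (∑ l ∈ Finset.range (m + 1), s k l * z ^ l) * u ^ k =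
      ∑ k ∈ Finset.range (m + 1), ((overlap m t : ℂ) * m.choose k * z ^ k) * u ^ k := by
    intro u z
    have h1 := hsum fun k l => z ^ l * u ^ k
    have h2 : ∑ x, ∑ y, S x y * (z ^ upCount y * u ^ upCount x) =
        (S * elemTensor fun _ => !![z * u, z; u, 1]).trace := by
      rw [trace_mul_elemTensor]
      refine Finset.sum_congr rfl fun x _ => Finset.sum_congr rfl fun y _ => ?_
      have h3 : ∀ a b : Fin 2, (!![z * u, z; u, 1] : M2) b a = ![z, 1] b * ![u, 1] a := by
        intro a b
        fin_cases a <;> fin_cases b <;> simp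
      simp only [h3]
      rw [Finset.prod_mul_distrib, prod_eq_pow_upCount ![z, 1], prod_eq_pow_upCount ![u, 1]]
      simp
    rw [h2, hS, trace_mapTensor_mul (trace_depol_mul _), mapTensor_elemTensor, trace_symProj_mul,
      symTrace_depol_rankOne, add_pow, Finset.mul_sum] at h1
    rw [Finset.sum_congr rfl fun k _ => Finset.sum_mul _ _ _]
    simp only [mul_assoc] at h1 ⊢
    rw [← h1]
    refine Finset.sum_congr rfl fun k _ => ?_
    rw [one_pow, mul_pow]
    ring
  have hs : ∀ k ∈ Finset.range (m + 1), ∀ l ∈ Finset.range (m + 1),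
      s k l = if k = l then (overlap m t : ℂ) * m.choose k else 0 := by
    intro k hk l hl
    refine eq_of_sum_pow_eq (N := m + 1) (a := s k)
      (b := fun l => if k = l then (overlap m t : ℂ) * m.choose k else 0) (fun z => ?_)
      (Finset.mem_range.mp hl)
    have := eq_of_sum_pow_eq (N := m + 1) (a := fun k => ∑ l ∈ Finset.range (m + 1), s k l * z ^ l)
      (b := fun k => (overlap m t : ℂ) * m.choose k * z ^ k) (fun u => hgen u z)
      (Finset.mem_range.mp hk)
    rw [this]
    simp only [ite_mul, zero_mul]
    rw [Finset.sum_ite_eq, if_pos hk]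
  rw [hsum, Finset.mul_sum]
  refine Finset.sum_congr rfl fun k hk => ?_
  rw [Finset.sum_eq_single_of_mem k hk fun l hl hkl => by
    rw [hs k hk l hl, if_neg hkl.symm, zero_mul], hs k hk k hk, if_pos rfl, mul_assoc]

/-- The image of `1` under the adjoint of the leg map, applied to its depolarized image. -/
theorem sum_legV_mapTensor (m : ℕ) (t : ℝ) :
    ∑ k : Fin (m + 2), legV m k * mapTensor m (depol t) (symProj m) * (legV m k)ᴴ =
      ((overlap m t : ℂ) * ((m + 2) / 2)) • (1 : M2) := by
  ext a b
  let G : ℕ → ℕ → ℂ := fun k l => if k + (1 - (a : ℕ)) = l + (1 - (b : ℕ)) then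
        1 / ((m + 1).choose (l + (1 - (b : ℕ))) : ℂ) else 0
  have h1 : (∑ k : Fin (m + 2), legV m k * mapTensor m (depol t) (symProj m) * (legV m k)ᴴ) a b =
      ∑ x, ∑ y, mapTensor m (depol t) (symProj m) x y * G (upCount x) (upCount y) := by
    have h0 : ∀ k : Fin (m + 2),
        (legV m k * mapTensor m (depol t) (symProj m) * (legV m k)ᴴ) a b =
        ∑ x, ∑ y, mapTensor m (depol t) (symProj m) x y * (legV m k a x * star (legV m k b y)) := by
      intro k
      simp only [Matrix.mul_apply, Matrix.conjTranspose_apply, Finset.sum_mul]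
      rw [Finset.sum_comm]
      exact Finset.sum_congr rfl fun x _ => Finset.sum_congr rfl fun y _ => by ring
    simp only [G, ← legV_mul_star, Matrix.sum_apply, h0, Finset.mul_sum]
    rw [Finset.sum_comm]
    exact Finset.sum_congr rfl fun x _ => Finset.sum_comm
  rw [h1, sum_mapTensor_symProj_mul, Matrix.smul_apply, smul_eq_mul, mul_assoc]
  congr 1
  have h3 : ((m : ℂ) + 1) ≠ 0 := by exact_mod_cast Nat.succ_ne_zero m
  have hch : ∀ k ∈ Finset.range (m + 1), (m.choose k : ℂ) ≠ 0 := fun k hk => by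
    exact_mod_cast (Nat.choose_pos (Finset.mem_range_succ_iff.mp hk)).ne'
  have hG : ∑ k ∈ Finset.range (m + 1), ((k : ℂ) + 1) = (m + 1) * (m + 2) / 2 := by
    have : ∀ N : ℕ, ∑ k ∈ Finset.range N, ((k : ℂ) + 1) = N * (N + 1) / 2 := by
      intro N
      induction N with
      | zero => simp
      | succ N ih => rw [Finset.sum_range_succ, ih]; push_cast; ring
    rw [this]; push_cast; ring
  by_cases hab : a = b
  · subst hab
    rw [Matrix.one_apply_eq, mul_one]
    fin_cases a
    · have h4 : ∀ k ∈ Finset.range (m + 1), (m.choose k : ℂ) * (1 / ((m + 1).choose (k + 1) : ℂ)) =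
          ((k : ℂ) + 1) / (m + 1) := by
        intro k hk
        have := hch k hk
        rw [choose_div_choose_succ_succ (Finset.mem_range_succ_iff.mp hk)]
        field_simp
      simp only [G, Nat.sub_zero, if_true]
      rw [Finset.sum_congr rfl h4, ← Finset.sum_div, hG]
      field_simp
    · have h4 : ∀ k ∈ Finset.range (m + 1), (m.choose k : ℂ) * (1 / ((m + 1).choose k : ℂ)) =
          ((m + 2) - ((k : ℂ) + 1)) / (m + 1) := by
        intro k hk
        have := hch k hk
        rw [choose_div_choose_succ (Finset.mem_range_succ_iff.mp hk)]
        field_simp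
        ring
      simp only [G, Nat.sub_self, if_true, add_zero]
      rw [Finset.sum_congr rfl h4, ← Finset.sum_div, Finset.sum_sub_distrib, hG, Finset.sum_const,
        Finset.card_range, nsmul_eq_mul]
      push_cast
      field_simp
      ring
  · rw [Matrix.one_apply_ne hab, mul_zero]
    refine Finset.sum_eq_zero fun k _ => ?_
    have : k + (1 - (a : ℕ)) ≠ k + (1 - (b : ℕ)) := by
      have := Fin.val_ne_of_ne hab
      omega
    simp only [G, if_neg this, mul_zero]

end Overlap

/-! ### Hilbert–Schmidt geometry -/

section HilbertSchmidtSpace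

variable {ι κ : Type*} [Fintype ι] [Fintype κ]

theorem hsInner_self_eq (A : Matrix ι ι ℂ) :
    hsInner A A = ((∑ i, ∑ j, ‖A j i‖ ^ 2 : ℝ) : ℂ) := by
  simp only [hsInner, Matrix.trace, Matrix.diag, Matrix.mul_apply, Matrix.conjTranspose_apply]
  push_cast
  refine Finset.sum_congr rfl fun i _ => Finset.sum_congr rfl fun j _ => ?_
  rw [Complex.star_def, Complex.conj_mul']

theorem hsInner_self_re_nonneg (A : Matrix ι ι ℂ) : 0 ≤ (hsInner A A).re := by
  rw [hsInner_self_eq, Complex.ofReal_re]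
  positivity

theorem hsNorm_sq (A : Matrix ι ι ℂ) : hsNorm A ^ 2 = (hsInner A A).re :=
  Real.sq_sqrt (hsInner_self_re_nonneg A)

theorem hsInner_self_eq_hsNorm_sq (A : Matrix ι ι ℂ) : hsInner A A = ((hsNorm A ^ 2 : ℝ) : ℂ) := by
  rw [hsNorm_sq, hsInner_self_eq, Complex.ofReal_re]

theorem hsNorm_nonneg (A : Matrix ι ι ℂ) : 0 ≤ hsNorm A := Real.sqrt_nonneg _

theorem hsNorm_pos {A : Matrix ι ι ℂ} (hA : A ≠ 0) : 0 < hsNorm A := by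
  refine Real.sqrt_pos.mpr ((hsInner_self_re_nonneg A).lt_of_ne fun h => hA ?_)
  rw [hsInner_self_eq, Complex.ofReal_re, eq_comm,
    Finset.sum_eq_zero_iff_of_nonneg fun _ _ => by positivity] at h
  ext i j
  have := (Finset.sum_eq_zero_iff_of_nonneg fun _ _ => by positivity).mp (h j (Finset.mem_univ j))
    i (Finset.mem_univ i)
  simpa using this

theorem hsNorm_smul (c : ℂ) (A : Matrix ι ι ℂ) : hsNorm (c • A) = ‖c‖ * hsNorm A := by
  have h : hsInner (c • A) (c • A) = ((‖c‖ ^ 2 : ℝ) : ℂ) * hsInner A A := by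
    simp only [hsInner, Matrix.conjTranspose_smul, Matrix.smul_mul, Matrix.mul_smul,
      Matrix.trace_smul, smul_eq_mul]
    rw [← mul_assoc, Complex.star_def, Complex.mul_conj']
    push_cast
    rfl
  rw [hsNorm, h, Complex.re_ofReal_mul, Real.sqrt_mul (by positivity), Real.sqrt_sq (norm_nonneg c),
    hsNorm]

theorem trace_conj_mul_re_le [DecidableEq ι] (B L : Matrix ι ι ℂ) :
    (Bᴴ * L * B * Lᴴ).trace.re ≤
      ((B * Bᴴ * (L * Lᴴ)).trace.re + (Bᴴ * B * (Lᴴ * L)).trace.re) / 2 := by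
  -- Expanding this square produces both diagonal terms and twice the real part of the cross term.
  have h := hsInner_self_re_nonneg (Lᴴ * B - B * Lᴴ)
  have h1 : hsInner (Lᴴ * B - B * Lᴴ) (Lᴴ * B - B * Lᴴ) =
      (B * Bᴴ * (L * Lᴴ)).trace + (Bᴴ * B * (Lᴴ * L)).trace - (Bᴴ * L * B * Lᴴ).trace -
        star (Bᴴ * L * B * Lᴴ).trace := by
    have e1 : (B * Bᴴ * (L * Lᴴ)).trace = (Bᴴ * L * Lᴴ * B).trace := by
      rw [Matrix.mul_assoc B, Matrix.trace_mul_comm B]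
      simp only [Matrix.mul_assoc]
    have e2 : (Bᴴ * B * (Lᴴ * L)).trace = (L * Bᴴ * B * Lᴴ).trace := by
      rw [← Matrix.mul_assoc, Matrix.trace_mul_comm _ L]
      simp only [Matrix.mul_assoc]
    have e3 : star (Bᴴ * L * B * Lᴴ).trace = (L * Bᴴ * Lᴴ * B).trace := by
      rw [← Matrix.trace_conjTranspose]
      simp only [Matrix.conjTranspose_mul, Matrix.conjTranspose_conjTranspose, Matrix.mul_assoc]
    rw [e1, e2, e3]
    simp only [hsInner, Matrix.conjTranspose_sub, Matrix.conjTranspose_mul,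
      Matrix.conjTranspose_conjTranspose, sub_mul, mul_sub, Matrix.trace_sub, Matrix.mul_assoc]
    ring
  rw [h1] at h
  simp only [Complex.sub_re, Complex.add_re, Complex.star_def, Complex.conj_re] at h
  linarith

/-- The norm of a completely positive map of the form `B ↦ ∑ L B L*` with
`∑ L L* = ∑ L* L = c` is at most `c`. -/
theorem sum_trace_conj_mul_re_le [DecidableEq ι] {J : Type*} [Fintype J] (L : J → Matrix ι ι ℂ)
    {c : ℝ} (h1 : ∑ j, L j * (L j)ᴴ = (c : ℂ) • 1) (h2 : ∑ j, (L j)ᴴ * L j = (c : ℂ) • 1)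
    (B : Matrix ι ι ℂ) :
    (∑ j, (Bᴴ * L j * B * (L j)ᴴ).trace).re ≤ c * (hsInner B B).re := by
  rw [Complex.re_sum]
  refine (Finset.sum_le_sum fun j _ => trace_conj_mul_re_le B (L j)).trans (le_of_eq ?_)
  rw [← Finset.sum_div, Finset.sum_add_distrib, ← Complex.re_sum, ← Complex.re_sum,
    ← Matrix.trace_sum, ← Matrix.trace_sum, ← Finset.mul_sum, ← Finset.mul_sum, h1, h2]
  simp only [Matrix.mul_smul, Matrix.mul_one, Matrix.trace_smul, smul_eq_mul,
    Complex.re_ofReal_mul, hsInner]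
  rw [Matrix.trace_mul_comm B]
  ring

end HilbertSchmidtSpace

/-! ### Largest singular value of the decorated leg map -/

section LegNorm

/-- The square of the largest singular value of the leg map. -/
def legGain (m : ℕ) (t : ℝ) : ℝ := overlap m t * (((m : ℝ) + 2) ^ 2 / (2 * (m + 1)))

/-- The adjoint of the undecorated transfer operator. -/
theorem hsInner_legE (m : ℕ) (B : M2) (T : MTensor m) :
    hsInner (legE m B) T = hsInner B (∑ k : Fin (m + 2), legW m k * T * (legW m k)ᴴ) := by
  simp only [hsInner, legE_apply, Matrix.conjTranspose_sum, Finset.sum_mul, Finset.mul_sum,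
    Matrix.trace_sum]
  refine Finset.sum_congr rfl fun k _ => ?_
  simp only [Matrix.conjTranspose_mul, Matrix.conjTranspose_conjTranspose]
  rw [Matrix.trace_mul_comm, ← Matrix.mul_assoc, Matrix.trace_mul_comm]
  simp only [Matrix.mul_assoc]

theorem sum_legW_mapTensor_legE_one (m : ℕ) (t : ℝ) :
    ∑ k : Fin (m + 2), legW m k * mapTensor m (depol t) (legE m 1) * (legW m k)ᴴ =
      (legGain m t : ℂ) • (1 : M2) := by
  have h : ∀ k : Fin (m + 2), legW m k * mapTensor m (depol t) (legE m 1) * (legW m k)ᴴ =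
      (((m : ℂ) + 2) / (m + 1)) • (singletK *
        (legV m k * mapTensor m (depol t) (symProj m) * (legV m k)ᴴ) * singletKᴴ) := by
    intro k
    simp only [legE_one, map_smul, legW, Matrix.conjTranspose_mul, Matrix.mul_smul,
      Matrix.smul_mul, Matrix.mul_assoc]
  rw [Finset.sum_congr rfl fun k _ => h k, ← Finset.smul_sum, ← Finset.sum_mul, ← Finset.mul_sum,
    sum_legV_mapTensor, Matrix.mul_smul, Matrix.smul_mul, Matrix.mul_one,
    singletK_mul_conjTranspose, smul_smul, legGain]
  congr 1
  have h3 : ((m : ℂ) + 1) ≠ 0 := by exact_mod_cast Nat.succ_ne_zero m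
  push_cast
  field_simp

/-- The two self-adjoint depolarizing factors merge into one with parameter `9^{-n}`. The sign
`(-1)^n` disappears, so this parameter lies in `[0, 1]` and Kraus operators exist. -/
theorem hsInner_EL (m n : ℕ) (B C : M2) :
    hsInner (EL (m + 1) n B) (EL (m + 1) n C) =
      hsInner (legE m B) (mapTensor m (depol ((1 / 9 : ℝ) ^ n : ℝ)) (legE m C)) := by
  have hstar : star ((-1 / 3 : ℂ) ^ n) = (-1 / 3) ^ n := by
    rw [star_pow]; congr 1; simp
  have h : hsInner (mapTensor m (depol ((-1 / 3) ^ n)) (legE m B))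
      (mapTensor m (depol ((-1 / 3) ^ n)) (legE m C)) =
      hsInner (legE m B) (mapTensor m (depol ((1 / 9 : ℝ) ^ n : ℝ)) (legE m C)) := by
    rw [hsInner_mapTensor (trace_depol_mul _) (conjTranspose_depol hstar), ← LinearMap.comp_apply,
      mapTensor_comp, depol_comp, ← mul_pow]
    congr 4
    push_cast
    norm_num
  rw [← h, ← EL_succ, ← EL_succ]

theorem hsInner_EL_one (m n : ℕ) (B : M2) :
    hsInner (EL (m + 1) n B) (EL (m + 1) n 1) =
      (legGain m ((1 / 9) ^ n) : ℂ) * hsInner B 1 := by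
  rw [hsInner_EL, hsInner_legE, sum_legW_mapTensor_legE_one]
  simp [hsInner]

theorem hsInner_EL_self_le (m n : ℕ) (B : M2) :
    (hsInner (EL (m + 1) n B) (EL (m + 1) n B)).re ≤
      legGain m ((1 / 9) ^ n) * (hsInner B B).re := by
  have ht0 : (0 : ℝ) ≤ (1 / 9) ^ n := by positivity
  have ht1 : ((1 : ℝ) / 9) ^ n ≤ 1 := pow_le_one₀ (by norm_num) (by norm_num)
  set t : ℝ := (1 / 9) ^ n
  let R : (Fin m → Option (Fin 3)) → MTensor m := fun s => elemTensor fun i => depolKraus t (s i)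
  have hR : ∀ s, (R s)ᴴ = R s := fun s => by
    simp only [R, conjTranspose_elemTensor, depolKraus_isHermitian]
  have hD : ∀ X, mapTensor m (depol t) X = ∑ s, R s * X * R s :=
    mapTensor_kraus (depolKraus t) (depol_kraus ht0 ht1)
  have hT := sum_legW_mapTensor_legE_one m t
  rw [hD, legE_apply] at hT
  simp only [Matrix.mul_sum, Matrix.sum_mul, Matrix.mul_one] at hT
  -- These are Kraus operators of the adjoint of `EL` composed with `EL`. Since `R` is Hermitian,
  -- swapping the outer indices replaces `L j` by its adjoint, so `h2` follows from `h1`.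
  let L : (Fin (m + 2) × (Fin m → Option (Fin 3)) × Fin (m + 2)) → M2 := fun j =>
    legW m j.1 * R j.2.1 * (legW m j.2.2)ᴴ
  have hL : ∀ j, (L j)ᴴ = legW m j.2.2 * R j.2.1 * (legW m j.1)ᴴ := fun j => by
    simp only [L, Matrix.conjTranspose_mul, Matrix.conjTranspose_conjTranspose, hR,
      Matrix.mul_assoc]
  have h1 : ∑ j, L j * (L j)ᴴ = (legGain m t : ℂ) • 1 := by
    rw [← hT]
    simp only [hL]
    simp only [Fintype.sum_prod_type, L, Matrix.mul_assoc]
  have h2 : ∑ j, (L j)ᴴ * L j = (legGain m t : ℂ) • 1 := by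
    rw [← h1]
    refine Fintype.sum_equiv ⟨fun j => (j.2.2, j.2.1, j.1), fun j => (j.2.2, j.2.1, j.1),
      fun _ => rfl, fun _ => rfl⟩ _ _ fun j => ?_
    simp only [hL, Equiv.coe_fn_mk]
    simp only [L]
  refine le_trans (le_of_eq (congrArg Complex.re ?_)) (sum_trace_conj_mul_re_le L h1 h2 B)
  rw [hsInner_EL, hsInner_legE, hD, legE_apply]
  simp only [hL]
  simp only [hsInner, L, Fintype.sum_prod_type, Matrix.mul_sum, Matrix.sum_mul,
    Matrix.trace_sum, Matrix.mul_assoc]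

end LegNorm

/-! ### Attained extrema of eigenvalues and singular values -/

theorem isLeast_sInf_hasEigenvalue {ι : Type*} [Fintype ι] [DecidableEq ι] [Nonempty ι]
    {M : Matrix ι ι ℂ} (hM : M.IsHermitian) :
    IsLeast {x : ℝ | Module.End.HasEigenvalue (Matrix.toLin' M) (x : ℂ)}
      (sInf {x : ℝ | Module.End.HasEigenvalue (Matrix.toLin' M) (x : ℂ)}) := by
  have hfin : {x : ℝ | Module.End.HasEigenvalue (Matrix.toLin' M) (x : ℂ)}.Finite :=
    (Module.End.finite_hasEigenvalue (Matrix.toLin' M)).preimage Complex.ofReal_injective.injOn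
  have hne : {x : ℝ | Module.End.HasEigenvalue (Matrix.toLin' M) (x : ℂ)}.Nonempty := by
    obtain ⟨i⟩ := ‹Nonempty ι›
    refine ⟨hM.eigenvalues i, Module.End.hasEigenvalue_of_hasEigenvector
      (x := (hM.eigenvectorBasis i : ι → ℂ)) ?_⟩
    rw [Module.End.hasEigenvector_iff, Module.End.mem_eigenspace_iff, Matrix.toLin'_apply]
    refine ⟨hM.mulVec_eigenvectorBasis i, fun h => ?_⟩
    refine hM.eigenvectorBasis.orthonormal.ne_zero i ?_
    ext j
    exact congrFun h j
  exact ⟨hne.csInf_mem hfin, fun x hx => csInf_le hfin.bddBelow hx⟩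

theorem isUnit_of_not_hasEigenvalue_zero {ι : Type*} [Fintype ι] [DecidableEq ι]
    {M : Matrix ι ι ℂ} (h : ¬ Module.End.HasEigenvalue (Matrix.toLin' M) 0) : IsUnit M := by
  by_contra hM
  rw [Matrix.isUnit_iff_isUnit_det, isUnit_iff_ne_zero, not_not] at hM
  obtain ⟨v, hv0, hv⟩ := Matrix.exists_mulVec_eq_zero_iff.mpr hM
  refine h (Module.End.hasEigenvalue_of_hasEigenvector (x := v) ?_)
  rw [Module.End.hasEigenvector_iff, Module.End.mem_eigenspace_iff, Matrix.toLin'_apply]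
  exact ⟨by rw [hv, zero_smul], hv0⟩

section SingularValues

variable {ι κ : Type*} [Fintype ι] [Fintype κ]

theorem isGreatest_hsRatios {T : Matrix ι ι ℂ →ₗ[ℂ] Matrix κ κ ℂ} {c : ℝ} {A : Matrix ι ι ℂ}
    (hA : A ≠ 0) (hTA : (hsInner (T A) (T A)).re = c * (hsInner A A).re)
    (hle : ∀ B, (hsInner (T B) (T B)).re ≤ c * (hsInner B B).re) :
    IsGreatest (hsRatios T) (Real.sqrt c) := by
  refine ⟨⟨A, hA, ?_⟩, ?_⟩
  · rw [eq_div_iff (hsNorm_pos hA).ne', hsNorm, hsNorm, hTA,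
      Real.sqrt_mul' _ (hsInner_self_re_nonneg A)]
  · rintro _ ⟨B, hB, rfl⟩
    rw [div_le_iff₀ (hsNorm_pos hB), hsNorm, hsNorm, ← Real.sqrt_mul' _ (hsInner_self_re_nonneg B)]
    exact Real.sqrt_le_sqrt (hle B)

theorem IsSingularValue.mem_hsRatios {T : Matrix ι ι ℂ →ₗ[ℂ] Matrix κ κ ℂ} {σ : ℝ}
    (h : IsSingularValue T σ) : σ ∈ hsRatios T := by
  obtain ⟨hσ, A, hA, hT⟩ := h
  refine ⟨A, hA, ?_⟩
  have h1 := hT A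
  rw [hsInner_self_eq_hsNorm_sq, hsInner_self_eq_hsNorm_sq A] at h1
  have h2 : hsNorm (T A) ^ 2 = (σ * hsNorm A) ^ 2 := by
    rw [mul_pow]; exact_mod_cast h1
  rw [eq_div_iff (hsNorm_pos hA).ne']
  exact ((sq_eq_sq₀ (hsNorm_nonneg _) (mul_nonneg hσ (hsNorm_nonneg _))).mp h2).symm

end SingularValues

/-! ### Explicit formulas and the threshold for invertibility -/

section LegResults

theorem legGain_eq (m : ℕ) (t : ℝ) :
    legGain m t = ((m : ℝ) + 2) ^ 2 / 2 ^ (m + 1) * ∑ r ∈ Finset.range (m / 2 + 1),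
      (m.choose (2 * r) : ℝ) / (2 * r + 1) * t ^ (2 * r) := by
  rw [legGain, overlap]
  field_simp
  ring

theorem legGain_le (m : ℕ) {t : ℝ} (ht : 0 ≤ t) :
    legGain m t ≤ ((m : ℝ) + 2) ^ 2 / (3 * 2 ^ (m + 1)) * (2 + (1 + t) ^ m) := by
  have h : ∑ r ∈ Finset.range (m / 2 + 1), (m.choose (2 * r) : ℝ) / (2 * r + 1) * t ^ (2 * r) ≤
      (2 + (1 + t) ^ m) / 3 := by
    rw [Finset.sum_range_succ']
    have := sum_choose_even_div_le m ht
    simp only [mul_zero, Nat.choose_zero_right, Nat.cast_one, Nat.cast_zero, zero_add, div_one,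
      pow_zero, mul_one]
    linarith
  rw [legGain_eq]
  refine (mul_le_mul_of_nonneg_left h (by positivity)).trans (le_of_eq ?_)
  field_simp

theorem legGain_nonneg (m : ℕ) {t : ℝ} (ht : 0 ≤ t) : 0 ≤ legGain m t := by
  rw [legGain_eq]
  positivity

theorem hsInner_one_one : hsInner (1 : M2) 1 = 2 := by
  simp [hsInner]

/-- The norm of `Q_L` is evaluated twice: as the image of the maximizer `1`, with `‖1‖₂² = 2`, and
as a multiple of `Vrho`. No direct computation of `‖V_ρ‖₂` is needed. -/
theorem legGain_eq_hsNorm_Vrho (m n : ℕ) :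
    legGain m ((1 / 9) ^ n) =
      ((m : ℝ) + 2) ^ 2 / 2 ^ (2 * m + 1) * hsNorm (Vrho m (alpha n)) ^ 2 := by
  have h1 : hsNorm (QL (m + 1) n) ^ 2 = legGain m ((1 / 9) ^ n) * 2 := by
    rw [hsNorm_sq]
    refine (congrArg Complex.re (hsInner_EL_one m n 1)).trans ?_
    rw [hsInner_one_one, Complex.re_ofReal_mul]
    rfl
  have h2 : hsNorm (QL (m + 1) n) = ((m : ℝ) + 2) / 2 ^ m * hsNorm (Vrho m (alpha n)) := by
    refine (congrArg (hsNorm (ι := Fin m → Fin 2)) (QL_succ m n)).trans ?_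
    rw [hsNorm_smul]
    congr 1
    have : ((m : ℂ) + 2) / 2 ^ m = (((m : ℝ) + 2) / 2 ^ m : ℝ) := by push_cast; rfl
    rw [this, Complex.norm_real, Real.norm_of_nonneg (by positivity)]
  rw [h2] at h1
  rw [eq_comm, ← mul_left_inj' (two_ne_zero' ℝ), ← h1, pow_succ, mul_pow, div_pow, ← pow_mul,
    mul_comm m 2]
  field_simp
  ring

theorem QL_isHermitian (m n : ℕ) : (QL (m + 1) n).IsHermitian := by
  have hstar : star ((-1 / 3 : ℂ) ^ n) = (-1 / 3) ^ n := by
    rw [star_pow]; congr 1; simp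
  have h : (mapTensor m (depol ((-1 / 3) ^ n)) (legE m 1))ᴴ =
      mapTensor m (depol ((-1 / 3) ^ n)) (legE m 1) := by
    rw [conjTranspose_mapTensor (conjTranspose_depol hstar), legE_apply,
      Matrix.conjTranspose_sum]
    simp
  rw [← EL_succ] at h
  exact h

theorem norm_alpha (n : ℕ) : Real.sqrt 3 * (‖alpha n‖ / 2) = (3 : ℝ) ^ (-(n : ℝ) + 1 / 2) := by
  rw [alpha, norm_mul, norm_pow, Real.rpow_add (by norm_num), Real.rpow_neg (by norm_num),
    Real.rpow_natCast, ← Real.sqrt_eq_rpow, norm_div, norm_neg]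
  simp
  ring

theorem le_QLeigenvalues (m n : ℕ) {x : ℝ} (hx : x ∈ QLeigenvalues (m + 1) n) :
    ((m : ℝ) + 2) / (3 * 2 ^ m) * (4 - (1 + (3 : ℝ) ^ (-(n : ℝ) + 1 / 2)) ^ m) ≤ x := by
  have hc : (0 : ℝ) < ((m : ℝ) + 2) / 2 ^ m := by positivity
  have h : Module.End.HasEigenvalue
      (Matrix.toLin' (((((m : ℝ) + 2) / 2 ^ m : ℝ) : ℂ) • Vrho m (alpha n))) (x : ℂ) := by
    have h' : ((((m : ℝ) + 2) / 2 ^ m : ℝ) : ℂ) = ((m : ℂ) + 2) / 2 ^ m := by push_cast; rfl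
    rw [h', ← QL_succ]
    exact hx
  have := le_of_hasEigenvalue_smul_Vrho hc h
  rwa [norm_alpha, div_div, mul_comm (2 ^ m : ℝ) 3] at this

/-- The threshold on `n` is precisely `m u ≤ ln 3` after taking logarithms; then `(1+u)^m ≤ e^{mu} ≤
3`. -/
theorem one_add_rpow_pow_lt_four {m n : ℕ} (hm : 0 < m)
    (h : Real.log m / Real.log 3 - Real.log (Real.log 3) / Real.log 3 + 1 / 2 ≤ (n : ℝ)) :
    (1 + (3 : ℝ) ^ (-(n : ℝ) + 1 / 2)) ^ m < 4 := by
  have hl : 0 < Real.log 3 := Real.log_pos (by norm_num)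
  have hm' : (0 : ℝ) < m := by exact_mod_cast hm
  set u : ℝ := (3 : ℝ) ^ (-(n : ℝ) + 1 / 2) with hu
  have hu0 : 0 < u := Real.rpow_pos_of_pos (by norm_num) _
  have h1 : m * u ≤ Real.log 3 := by
    rw [← Real.log_le_log_iff (by positivity) hl, Real.log_mul hm'.ne' hu0.ne', hu,
      Real.log_rpow (by norm_num)]
    have h2 := mul_le_mul_of_nonneg_right h hl.le
    have h3 : (Real.log m / Real.log 3 - Real.log (Real.log 3) / Real.log 3 + 1 / 2) * Real.log 3 =
        Real.log m - Real.log (Real.log 3) + 1 / 2 * Real.log 3 := by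
      field_simp
    linarith
  calc (1 + u) ^ m ≤ (Real.exp u) ^ m :=
        pow_le_pow_left₀ (by positivity) (by linarith [Real.add_one_le_exp u]) m
    _ = Real.exp (m * u) := (Real.exp_nat_mul u m).symm
    _ ≤ Real.exp (Real.log 3) := Real.exp_le_exp.mpr h1
    _ = 3 := Real.exp_log (by norm_num)
    _ < 4 := by norm_num

theorem isGreatest_hsRatios_EL (m n : ℕ) :
    IsGreatest (hsRatios (EL (m + 1) n)) (Real.sqrt (legGain m ((1 / 9) ^ n))) :=
  isGreatest_hsRatios one_ne_zero
    (by rw [hsInner_EL_one, Complex.re_ofReal_mul]) (hsInner_EL_self_le m n)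

theorem isSingularValue_EL (m n : ℕ) :
    IsSingularValue (EL (m + 1) n) (Real.sqrt (legGain m ((1 / 9) ^ n))) := by
  refine ⟨Real.sqrt_nonneg _, 1, one_ne_zero, fun B => ?_⟩
  rw [hsInner_EL_one, ← Complex.ofReal_pow, Real.sq_sqrt (legGain_nonneg m (by positivity))]

end LegResults

end DecoratedAKLT

end

theorem mainTheorem5 (d : ℕ) (hd : 3 ≤ d) (n : ℕ) :
    (DecoratedAKLT.QL d n).IsHermitian ∧
    IsLeast (DecoratedAKLT.QLeigenvalues d n) (DecoratedAKLT.qL d n) ∧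
    ((d : ℝ) + 1) / (3 * 2 ^ (d - 1)) * (4 - (1 + (3 : ℝ) ^ (-(n : ℝ) + 1 / 2)) ^ (d - 1))
      ≤ DecoratedAKLT.qL d n ∧
    IsGreatest (DecoratedAKLT.hsRatios (DecoratedAKLT.EL d n))
      (DecoratedAKLT.schattenInf (DecoratedAKLT.EL d n)) ∧
    IsGreatest {σ : ℝ | DecoratedAKLT.IsSingularValue (DecoratedAKLT.EL d n) σ}
      (DecoratedAKLT.schattenInf (DecoratedAKLT.EL d n)) ∧
    (Real.log ((d : ℝ) - 1) / Real.log 3 - Real.log (Real.log 3) / Real.log 3 + 1 / 2 ≤ (n : ℝ) →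
      IsUnit (DecoratedAKLT.QL d n) ∧
      DecoratedAKLT.schattenInf (DecoratedAKLT.EL d n) ^ 2 =
        ((d : ℝ) + 1) ^ 2 / 2 ^ (2 * d - 1) *
          DecoratedAKLT.hsNorm (DecoratedAKLT.Vrho (d - 1) (DecoratedAKLT.alpha n)) ^ 2 ∧
      ((d : ℝ) + 1) ^ 2 / 2 ^ (2 * d - 1) *
          DecoratedAKLT.hsNorm (DecoratedAKLT.Vrho (d - 1) (DecoratedAKLT.alpha n)) ^ 2 ≤
        ((d : ℝ) + 1) ^ 2 / (3 * 2 ^ d) *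
          (2 + (1 + (3 : ℝ) ^ (-2 * (n : ℝ))) ^ (d - 1))) := by
  obtain ⟨m, rfl⟩ : ∃ m, d = m + 1 := ⟨d - 1, by omega⟩
  have hH := DecoratedAKLT.QL_isHermitian m n
  have hleast : IsLeast (DecoratedAKLT.QLeigenvalues (m + 1) n) (DecoratedAKLT.qL (m + 1) n) :=
    DecoratedAKLT.isLeast_sInf_hasEigenvalue hH
  have hlow := DecoratedAKLT.le_QLeigenvalues m n hleast.1
  have hgr := DecoratedAKLT.isGreatest_hsRatios_EL m n
  have hsch : DecoratedAKLT.schattenInf (DecoratedAKLT.EL (m + 1) n) =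
      Real.sqrt (DecoratedAKLT.legGain m ((1 / 9) ^ n)) := hgr.csSup_eq
  have hd1 : ((m + 1 : ℕ) : ℝ) + 1 = m + 2 := by push_cast; ring
  have hd2 : ((m + 1 : ℕ) : ℝ) - 1 = m := by push_cast; ring
  have hexp : 2 * (m + 1) - 1 = 2 * m + 1 := by omega
  have h9 : (3 : ℝ) ^ (-2 * (n : ℝ)) = (1 / 9) ^ n := by
    rw [Real.rpow_mul (by norm_num), Real.rpow_natCast]
    norm_num [Real.rpow_neg]
  rw [hd1, hd2, hsch, hexp, h9]
  -- Every singular value is one of the norm ratios, so the largest ratio, itself a singular value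
  -- with vector `1`, is the largest singular value.
  refine ⟨hH, hleast, hlow, hgr, ⟨DecoratedAKLT.isSingularValue_EL m n,
    fun σ hσ => hgr.2 hσ.mem_hsRatios⟩, fun hn => ⟨?_, ?_, ?_⟩⟩
  · refine DecoratedAKLT.isUnit_of_not_hasEigenvalue_zero fun h0 => ?_
    have hle : DecoratedAKLT.qL (m + 1) n ≤ 0 := hleast.2 (by
      change Module.End.HasEigenvalue _ ((0 : ℝ) : ℂ)
      rwa [Complex.ofReal_zero])
    have h4 := DecoratedAKLT.one_add_rpow_pow_lt_four (by omega) hn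
    have hpos : 0 < ((m : ℝ) + 2) / (3 * 2 ^ m) *
        (4 - (1 + (3 : ℝ) ^ (-(n : ℝ) + 1 / 2)) ^ m) :=
      mul_pos (by positivity) (by linarith)
    linarith
  · rw [Real.sq_sqrt (DecoratedAKLT.legGain_nonneg m (by positivity))]
    exact DecoratedAKLT.legGain_eq_hsNorm_Vrho m n
  · exact (DecoratedAKLT.legGain_eq_hsNorm_Vrho m n).symm.trans_le
      (DecoratedAKLT.legGain_le m (by positivity))
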